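/- Let $S=\begin{pmatrix}0&1\\-1&0\end{pmatrix}$ and $R=\begin{pmatrix}1&1\\0&1\end{pmatrix}$ be the standard generators of $\mathrm{SL}(2,\mathbb Z)$, and let $\mathrm{SL}(2,\mathbb Z)$ act on $\mathbb P^1(\mathbb C)=\mathbb C\cup\{\infty\}$ by $x\mapsto\frac{ax+b}{cx+d}$. Let $\mathrm{Bir}(\mathbb P^2)$ be the group of birational maps of $\mathbb P^2(\mathbb C)$, written in affine coordinates $(x,y)$. The degree of $f\in\mathrm{Bir}(\mathbb P^2)$ is the common degree $d$ of homogeneous polynomials $f_0,f_1,f_2$ without common factor such that $f=(f_0:f_1:f_2)$; $f$ is called parabolic if the sequence $(\deg f^n)_{n\in\mathbb N}$ grows linearly or quadratically in $n$. An injective group morphism $\theta\colon\mathrm{SL}(2,\mathbb Z)\to\mathrm{Bir}(\mathbb P^2)$ is called a parabolic embedding if every element of infinite order of its image is parabolic. Proposition. Let $m>0$ and let $P\in\mathbb C(x)$ be a rational function with exactly $m$ zeros and $m$ poles, all simple and lying in $\mathbb C$. Suppose that these $2m$ points lie on pairwise distinct orbits of $\mathrm{SL}(2,\mathbb Z)$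 on $\mathbb P^1(\mathbb C)$ and have no isotropy (the stabiliser of each of them is $\{\pm I\}$, i.e. is trivial in $\mathrm{PSL}(2,\mathbb Z)$). Then there is a unique group morphism $\theta_P\colon\mathrm{SL}(2,\mathbb Z)\to\mathrm{Bir}(\mathbb P^2)$ with $$\theta_P(S)=\Bigl(-\frac1x,\ \mathbf i\,y\Bigr),\qquad \theta_P(RS)=\varphi_P\circ\Bigl(\frac{x-1}{x},\ y\Bigr)\circ\varphi_P^{-1},\qquad \varphi_P=(x,\ y\,P(x)),$$ and $\theta_P$ is a parabolic embedding. -/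

import Mathlib

/-! ### The modular group and its action on the projective line -/

/-- The matrix `R = [[1, 1], [0, 1]]` of `SL(2, ℤ)`. -/
def sl2R : Matrix.SpecialLinearGroup (Fin 2) ℤ :=
  ⟨!![1, 1; 0, 1], by simp [Matrix.det_fin_two]⟩

/-- The matrix `S = [[0, 1], [-1, 0]]` of `SL(2, ℤ)`. -/
def sl2S : Matrix.SpecialLinearGroup (Fin 2) ℤ :=
  ⟨!![0, 1; -1, 0], by simp [Matrix.det_fin_two]⟩

/-- The action `x ↦ (a x + b) / (c x + d)` of `SL(2, ℤ)` on `ℙ¹(ℂ) = ℂ ∪ {∞}`, through Mathlib's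
action of `GL(2, ℂ)` on `OnePoint ℂ`. -/
noncomputable def moebius (M : Matrix.SpecialLinearGroup (Fin 2) ℤ) (p : OnePoint ℂ) :
    OnePoint ℂ :=
  Matrix.SpecialLinearGroup.mapGL ℂ M • p

/-- The points of `ℂ` where the rational function `P` vanishes or has a pole
(`P.num` and `P.denom` are coprime). -/
def zerosAndPoles (P : RatFunc ℂ) : Set ℂ :=
  {p | P.num.IsRoot p ∨ P.denom.IsRoot p}

/-! ### The Cremona group -/

/-- The function field `ℂ(x, y)` of the plane. -/
abbrev PlaneField : Type := FractionRing (MvPolynomial (Fin 2) ℂ)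

/-- The coordinate function `x` in `ℂ(x, y)`. -/
noncomputable def coordX : PlaneField :=
  algebraMap (MvPolynomial (Fin 2) ℂ) PlaneField (MvPolynomial.X 0)

/-- The coordinate function `y` in `ℂ(x, y)`. -/
noncomputable def coordY : PlaneField :=
  algebraMap (MvPolynomial (Fin 2) ℂ) PlaneField (MvPolynomial.X 1)

/-- The Cremona group `Bir(ℙ²)` over `ℂ`: a birational map `f` is given by its pull-back `f^*`, a
`ℂ`-automorphism of `ℂ(x, y)`. As `(f ∘ g)^* = g^* ∘ f^*`, the opposite group is taken, so that
`f * g` is the composition `f ∘ g` of birational maps. -/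
abbrev Cremona : Type := (PlaneField ≃ₐ[ℂ] PlaneField)ᵐᵒᵖ

/-- The pull-back `f^*` of rational functions by the birational map `f`. -/
def pullback (f : Cremona) : PlaneField ≃ₐ[ℂ] PlaneField := f.unop

/-- `f` is the birational map `(x, y) ⇢ (a, b)` in affine coordinates, `a, b ∈ ℂ(x, y)`. -/
def HasCoords (f : Cremona) (a b : PlaneField) : Prop :=
  pullback f coordX = a ∧ pullback f coordY = b

/-- `P(t)` in `ℂ(x, y)` for a rational function `P ∈ ℂ(x)` and `t ∈ ℂ(x, y)`. -/
noncomputable def ratSubst (P : RatFunc ℂ) (t : PlaneField) : PlaneField :=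
  RatFunc.eval (algebraMap ℂ PlaneField) t P

/-- Restriction `F ↦ F(x, y, 1)` of a polynomial in homogeneous coordinates to the affine chart
`(x, y) ↦ (x : y : 1)`. -/
noncomputable def dehomogenize : MvPolynomial (Fin 3) ℂ →ₐ[ℂ] PlaneField :=
  MvPolynomial.aeval ![coordX, coordY, 1]

/-- `f` is the map `(x : y : z) ⇢ (F 0 : F 1 : F 2)`, where the `F i` are homogeneous polynomials
of degree `d` without common factor. -/
structure IsHomogeneousForm (f : Cremona) (F : Fin 3 → MvPolynomial (Fin 3) ℂ) (d : ℕ) :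
    Prop where
  homogeneous : ∀ i, (F i).IsHomogeneous d
  no_common_factor : ∀ q : MvPolynomial (Fin 3) ℂ, (∀ i, q ∣ F i) → IsUnit q
  last_ne_zero : dehomogenize (F 2) ≠ 0
  pullback_x : pullback f coordX = dehomogenize (F 0) / dehomogenize (F 2)
  pullback_y : pullback f coordY = dehomogenize (F 1) / dehomogenize (F 2)

/-! Every birational map of the plane has a homogeneous form without common factor, and the degree
of such a form depends on the map only. -/

open MvPolynomial in
theorem exists_homogenization (p : MvPolynomial (Fin 2) ℂ) : ∃ (d : ℕ) (F : MvPolynomial (Fin 3) ℂ),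
    F.IsHomogeneous d ∧ dehomogenize F = algebraMap _ PlaneField p := by
  induction p using MvPolynomial.induction_on with
  | C a =>
    refine ⟨0, C a, isHomogeneous_C _ a, ?_⟩
    rw [dehomogenize, ← MvPolynomial.algebraMap_eq, AlgHom.commutes, ← MvPolynomial.algebraMap_eq,
      ← IsScalarTower.algebraMap_apply]
  | add p q hp hq =>
    obtain ⟨d, F, hF, hF'⟩ := hp
    obtain ⟨e, G, hG, hG'⟩ := hq
    refine ⟨d + e, F * X 2 ^ e + G * X 2 ^ d, ?_, ?_⟩
    · have h1 := hF.mul ((isHomogeneous_X ℂ (2 : Fin 3)).pow e)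
      have h2 := hG.mul ((isHomogeneous_X ℂ (2 : Fin 3)).pow d)
      rw [one_mul] at h1 h2
      rw [add_comm e d] at h2
      exact h1.add h2
    · have h : dehomogenize (X 2) = 1 := by simp [dehomogenize]
      simp [hF', hG', h]
  | mul_X p i hp =>
    obtain ⟨d, F, hF, hF'⟩ := hp
    refine ⟨d + 1, F * X i.castSucc, hF.mul (isHomogeneous_X _ _), ?_⟩
    rw [map_mul, map_mul, hF']
    congr 1
    fin_cases i <;> simp [dehomogenize, coordX, coordY]


open MvPolynomial in
theorem aeval_scale_of_homogeneous {A : Type*} [CommRing A] [Algebra ℂ A] {d : ℕ} {F : MvPolynomial (Fin 3) ℂ}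
    (hF : F.IsHomogeneous d) (v : Fin 3 → A) (c : A) :
    aeval (fun i => v i * c) F = aeval v F * c ^ d := by
  rw [aeval_def, aeval_def, eval₂_eq', eval₂_eq', Finset.sum_mul]
  refine Finset.sum_congr rfl fun m hm => ?_
  have h1 : ∑ i, m i = d := by
    have := hF.degree_eq_sum_deg_support hm
    rw [this]
    exact (Finset.sum_subset (Finset.subset_univ _) fun i _ h => by simpa using h).symm
  rw [← h1, mul_assoc, ← Finset.prod_pow_eq_pow_sum, ← Finset.prod_mul_distrib]
  simp only [mul_pow]

open MvPolynomial in
theorem eq_zero_of_dehomogenize_eq_zero {d : ℕ} {F : MvPolynomial (Fin 3) ℂ} (hF : F.IsHomogeneous d)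
    (h : dehomogenize F = 0) : F = 0 := by
  let g : MvPolynomial (Fin 2) ℂ := aeval ![X 0, X 1, 1] F
  have hg : g = 0 := by
    have : algebraMap _ PlaneField g = dehomogenize F := by
      simp only [g, dehomogenize]
      rw [← IsScalarTower.toAlgHom_apply ℂ (MvPolynomial (Fin 2) ℂ) PlaneField]
      rw [← AlgHom.comp_apply]
      congr 1
      ext i
      fin_cases i <;> simp [coordX, coordY]
    rw [h] at this
    exact (FaithfulSMul.algebraMap_eq_zero_iff _ _).1 this
  have hv : ∀ v : Fin 3 → ℂ, eval v (X 2 * F) = 0 := by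
    intro v
    rw [map_mul, eval_X]
    by_cases hz : v 2 = 0
    · simp [hz]
    have h1 : aeval ![v 0 / v 2, v 1 / v 2, 1] F = (0 : ℂ) := by
      have : aeval ![v 0 / v 2, v 1 / v 2] g = (0 : ℂ) := by rw [hg, map_zero]
      rw [← this]
      simp only [g]
      rw [← AlgHom.comp_apply]
      congr 1
      ext i
      fin_cases i <;> simp
    have h2 := aeval_scale_of_homogeneous hF ![v 0 / v 2, v 1 / v 2, 1] (v 2)
    rw [h1, zero_mul] at h2
    have h3 : (fun i => (![v 0 / v 2, v 1 / v 2, 1] : Fin 3 → ℂ) i * v 2) = v := by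
      ext i
      fin_cases i <;> simp [hz]
    rw [h3, aeval_eq_eval] at h2
    change v 2 * eval v F = 0
    rw [show eval v F = 0 from h2, mul_zero]
  have := MvPolynomial.funext (p := X 2 * F) (q := 0) (by simpa using hv)
  exact (mul_eq_zero.1 this).resolve_left (X_ne_zero _)

open MvPolynomial in
theorem homogeneous_of_dvd_homogeneous {d : ℕ} {q G F : MvPolynomial (Fin 3) ℂ} (hF : F.IsHomogeneous d)
    (h0 : F ≠ 0) (h : F = q * G) : ∃ e, q.IsHomogeneous e := by
  let v : Fin 3 → Polynomial (MvPolynomial (Fin 3) ℂ) := fun i => Polynomial.C (X i)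
  obtain ⟨Φ, hdef⟩ : ∃ Φ : MvPolynomial (Fin 3) ℂ →ₐ[ℂ] Polynomial (MvPolynomial (Fin 3) ℂ),
      ∀ p, Φ p = aeval (fun i => v i * Polynomial.X) p :=
    ⟨aeval fun i => v i * Polynomial.X, fun _ => rfl⟩
  have hv : ∀ p, aeval v p = Polynomial.C p := by
    intro p
    induction p using MvPolynomial.induction_on with
    | C a => rw [← MvPolynomial.algebraMap_eq, AlgHom.commutes]; rfl
    | add p q hp hq => rw [map_add, hp, hq, map_add]
    | mul_X p i hp => rw [map_mul, hp, aeval_X, map_mul]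
  have hΦ : ∀ {e p}, IsHomogeneous p e → Φ p = Polynomial.monomial e p := by
    intro e p hp
    rw [← Polynomial.C_mul_X_pow_eq_monomial, ← hv, hdef]
    exact aeval_scale_of_homogeneous hp v _
  have hc : ∀ p k, (Φ p).coeff k = homogeneousComponent k p := by
    intro p k
    conv_lhs => rw [← sum_homogeneousComponent p]
    rw [map_sum, Polynomial.finsetSum_coeff]
    simp_rw [hΦ (homogeneousComponent_isHomogeneous _ p), Polynomial.coeff_monomial]
    rw [Finset.sum_ite_eq']
    split_ifs with hk
    · rfl
    · rw [homogeneousComponent_eq_zero]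
      simpa using hk
  have hq : q ≠ 0 := by rintro rfl; simp [h] at h0
  have hG : G ≠ 0 := by rintro rfl; simp [h] at h0
  have hne : ∀ p, p ≠ 0 → Φ p ≠ 0 := by
    intro p hp h
    apply hp
    rw [← sum_homogeneousComponent p]
    exact Finset.sum_eq_zero fun k _ => by rw [← hc, h, Polynomial.coeff_zero]
  have hm : Φ q * Φ G = Polynomial.monomial d F := by rw [← map_mul, ← h, hΦ hF]
  have h1 := Polynomial.natDegree_mul (hne q hq) (hne G hG)
  have h2 := Polynomial.natTrailingDegree_mul (hne q hq) (hne G hG)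
  rw [hm, Polynomial.natDegree_monomial_eq _ h0] at h1
  rw [hm, Polynomial.natTrailingDegree_monomial h0] at h2
  have h3 := (Φ q).natTrailingDegree_le_natDegree
  have h4 := (Φ G).natTrailingDegree_le_natDegree
  refine ⟨(Φ q).natDegree, ?_⟩
  have : q = homogeneousComponent (Φ q).natDegree q := by
    conv_lhs => rw [← sum_homogeneousComponent q]
    refine Finset.sum_eq_single _ ?_ ?_
    · intro k _ hk
      rw [← hc]
      rcases lt_or_gt_of_ne hk with hk | hk
      · exact Polynomial.coeff_eq_zero_of_lt_natTrailingDegree (by omega)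
      · exact Polynomial.coeff_eq_zero_of_natDegree_lt hk
    · intro hk
      apply homogeneousComponent_eq_zero
      simpa using hk
  have h5 := homogeneousComponent_isHomogeneous (Φ q).natDegree q
  rwa [← this] at h5

theorem homogeneousForm_degree_unique {f : Cremona} {F G : Fin 3 → MvPolynomial (Fin 3) ℂ} {d e : ℕ}
    (hF : IsHomogeneousForm f F d) (hG : IsHomogeneousForm f G e) : d = e := by
  classical
  have key : ∀ i, F i * G 2 = G i * F 2 := by
    intro i
    have h : dehomogenize (F i * G 2 - G i * F 2) = 0 := by
      have hx := hF.pullback_x.symm.trans hG.pullback_x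
      have hy := hF.pullback_y.symm.trans hG.pullback_y
      rw [div_eq_div_iff hF.last_ne_zero hG.last_ne_zero] at hx hy
      rw [map_sub, map_mul, map_mul, sub_eq_zero]
      fin_cases i
      · exact hx
      · exact hy
      · exact mul_comm _ _
    have h2 := (hG.homogeneous i).mul (hF.homogeneous 2)
    rw [add_comm] at h2
    exact sub_eq_zero.1 (eq_zero_of_dehomogenize_eq_zero (((hF.homogeneous i).mul (hG.homogeneous 2)).sub h2) h)
  have aux : ∀ {A B : Fin 3 → MvPolynomial (Fin 3) ℂ},
      (∀ q : MvPolynomial (Fin 3) ℂ, (∀ i, q ∣ A i) → IsUnit q) →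
      (∀ i, A i * B 2 = B i * A 2) → A 2 ∣ B 2 := by
    intro A B hA hAB
    let _ : GCDMonoid (MvPolynomial (Fin 3) ℂ) := UniqueFactorizationMonoid.toGCDMonoid _
    have h1 : A 2 ∣ gcd (A 0 * B 2) (gcd (A 1 * B 2) (A 2 * B 2)) :=
      dvd_gcd ⟨B 0, by rw [hAB, mul_comm]⟩ (dvd_gcd ⟨B 1, by rw [hAB, mul_comm]⟩ ⟨B 2, rfl⟩)
    have h2 : Associated (gcd (A 0 * B 2) (gcd (A 1 * B 2) (A 2 * B 2)))
        (gcd (A 0) (gcd (A 1) (A 2)) * B 2) :=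
      (Associated.gcd .rfl (gcd_mul_right' _ _ _)).trans (gcd_mul_right' _ _ _)
    have h3 : IsUnit (gcd (A 0) (gcd (A 1) (A 2))) := by
      apply hA
      intro i
      fin_cases i
      · exact gcd_dvd_left _ _
      · exact (gcd_dvd_right _ _).trans (gcd_dvd_left _ _)
      · exact (gcd_dvd_right _ _).trans (gcd_dvd_right _ _)
    have h4 := h1.trans h2.dvd
    rwa [h3.dvd_mul_left] at h4
  have hF0 : F 2 ≠ 0 := fun h => hF.last_ne_zero (by rw [h, map_zero])
  have hG0 : G 2 ≠ 0 := fun h => hG.last_ne_zero (by rw [h, map_zero])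
  have h1 : F 2 ∣ G 2 := aux hF.no_common_factor key
  have h2 : G 2 ∣ F 2 := aux hG.no_common_factor fun i => (key i).symm
  have h3 := MvPolynomial.totalDegree_le_of_dvd_of_isDomain h1 hG0
  have h4 := MvPolynomial.totalDegree_le_of_dvd_of_isDomain h2 hF0
  rw [(hF.homogeneous 2).totalDegree hF0, (hG.homogeneous 2).totalDegree hG0] at h3 h4
  omega

open MvPolynomial in
theorem exists_homogeneousForm (f : Cremona) :
    ∃ (d : ℕ) (F : Fin 3 → MvPolynomial (Fin 3) ℂ), IsHomogeneousForm f F d := by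
  classical
  let p : ℕ → Prop := fun d => ∃ F : Fin 3 → MvPolynomial (Fin 3) ℂ,
    (∀ i, (F i).IsHomogeneous d) ∧ dehomogenize (F 2) ≠ 0 ∧
    pullback f coordX = dehomogenize (F 0) / dehomogenize (F 2) ∧
    pullback f coordY = dehomogenize (F 1) / dehomogenize (F 2)
  have hp : ∃ d, p d := by
    obtain ⟨a, s, hs, ha⟩ := IsFractionRing.div_surjective (A := MvPolynomial (Fin 2) ℂ)
      (pullback f coordX)
    obtain ⟨b, t, ht, hb⟩ := IsFractionRing.div_surjective (A := MvPolynomial (Fin 2) ℂ)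
      (pullback f coordY)
    obtain ⟨da, A, hA, hA'⟩ := exists_homogenization a
    obtain ⟨db, B, hB, hB'⟩ := exists_homogenization b
    obtain ⟨ds, S, hS, hS'⟩ := exists_homogenization s
    obtain ⟨dt, T, hT, hT'⟩ := exists_homogenization t
    have hs0 : algebraMap _ PlaneField s ≠ 0 := by
      rw [Ne, FaithfulSMul.algebraMap_eq_zero_iff]
      exact nonZeroDivisors.ne_zero hs
    have ht0 : algebraMap _ PlaneField t ≠ 0 := by
      rw [Ne, FaithfulSMul.algebraMap_eq_zero_iff]
      exact nonZeroDivisors.ne_zero ht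
    have hX : dehomogenize (X 2) = 1 := by simp [dehomogenize]
    have hZ : ∀ n, (X 2 ^ n : MvPolynomial (Fin 3) ℂ).IsHomogeneous n := fun n => by
      simpa using (isHomogeneous_X ℂ (2 : Fin 3)).pow n
    refine ⟨da + db + ds + dt, ![A * T * X 2 ^ (db + ds), B * S * X 2 ^ (da + dt),
      S * T * X 2 ^ (da + db)], ?_, ?_, ?_, ?_⟩
    · intro i
      fin_cases i
      · have := (hA.mul hT).mul (hZ (db + ds))
        rwa [show da + dt + (db + ds) = da + db + ds + dt by ring] at this
      · have := (hB.mul hS).mul (hZ (da + dt))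
        rwa [show db + ds + (da + dt) = da + db + ds + dt by ring] at this
      · have := (hS.mul hT).mul (hZ (da + db))
        rwa [show ds + dt + (da + db) = da + db + ds + dt by ring] at this
    · simp [hX, hS', hT', hs0, ht0]
    · simp [hX, hS', hT', hA', ← ha]
      field_simp
    · simp [hX, hS', hT', hB', ← hb]
      field_simp
  obtain ⟨F, h1, h2, h3, h4⟩ := Nat.find_spec hp
  refine ⟨Nat.find hp, F, h1, ?_, h2, h3, h4⟩
  intro q hq
  choose G hG using hq
  have hF2 : F 2 ≠ 0 := fun h => h2 (by rw [h, map_zero])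
  have hq0 : q ≠ 0 := by rintro rfl; exact hF2 (by rw [hG, zero_mul])
  obtain ⟨e, he⟩ := homogeneous_of_dvd_homogeneous (h1 2) hF2 (hG 2)
  obtain ⟨k, hk⟩ := homogeneous_of_dvd_homogeneous (h1 2) hF2 ((hG 2).trans (mul_comm _ _))
  have hek : e + k = Nat.find hp := by
    have := he.mul hk
    rw [← hG] at this
    exact this.inj_right (h1 2) hF2
  have hdq : dehomogenize q ≠ 0 := fun h => hq0 (eq_zero_of_dehomogenize_eq_zero he h)
  have hGi : ∀ i, (G i).IsHomogeneous k := by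
    intro i
    by_cases hi : G i = 0
    · rw [hi]; exact isHomogeneous_zero _ _ _
    · have hFi : F i ≠ 0 := by rw [hG]; exact mul_ne_zero hq0 hi
      obtain ⟨l, hl⟩ := homogeneous_of_dvd_homogeneous (h1 i) hFi ((hG i).trans (mul_comm _ _))
      have := he.mul hl
      rw [← hG] at this
      have := this.inj_right (h1 i) hFi
      rwa [show k = l by omega]
  have hpk : p k := by
    refine ⟨G, hGi, ?_, ?_, ?_⟩
    · intro h
      apply h2
      rw [hG, map_mul, h, mul_zero]
    · rw [h3, hG 0, hG 2, map_mul, map_mul, mul_div_mul_left _ _ hdq]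
    · rw [h4, hG 1, hG 2, map_mul, map_mul, mul_div_mul_left _ _ hdq]
  have := Nat.find_min' hp hpk
  have he0 : e = 0 := by omega
  subst he0
  rw [← totalDegree_zero_iff_isHomogeneous, totalDegree_eq_zero_iff_eq_C] at he
  rw [he]
  refine IsUnit.map C (IsUnit.mk0 _ fun h => hq0 ?_)
  rw [he, h, C_0]

/-- The degree of a birational map of `ℙ²`: the common degree of the components of its homogeneous
forms without common factor. -/
noncomputable def degree (f : Cremona) : ℕ := (exists_homogeneousForm f).choose

theorem degree_eq {f : Cremona} {F : Fin 3 → MvPolynomial (Fin 3) ℂ} {d : ℕ}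
    (hF : IsHomogeneousForm f F d) : degree f = d :=
  homogeneousForm_degree_unique (exists_homogeneousForm f).choose_spec.choose_spec hF

/-! ### Parabolic maps and embeddings, and the twisted morphism -/

/-- `f` is parabolic: the sequence `deg (f ^ n)` grows linearly or quadratically. -/
def IsParabolicMap (f : Cremona) : Prop :=
  (fun n : ℕ => (degree (f ^ n) : ℝ)) =Θ[Filter.atTop] (fun n : ℕ => (n : ℝ)) ∨
  (fun n : ℕ => (degree (f ^ n) : ℝ)) =Θ[Filter.atTop] (fun n : ℕ => (n : ℝ) ^ 2)

/-- A parabolic embedding of `SL(2, ℤ)` into the Cremona group. -/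
def IsParabolicEmbedding (θ : Matrix.SpecialLinearGroup (Fin 2) ℤ →* Cremona) : Prop :=
  Function.Injective θ ∧ ∀ f ∈ θ.range, ¬ IsOfFinOrder f → IsParabolicMap f

/-- `θ` is a morphism with `θ(S) = (-1/x, i y)` and `θ(RS) = φ ∘ t ∘ φ⁻¹`, where `φ` and `t` are the
birational maps `φ = (x, y P(x))` and `t = ((x - 1)/x, y)`. -/
def IsTwistedMorphism (P : RatFunc ℂ) (θ : Matrix.SpecialLinearGroup (Fin 2) ℤ →* Cremona) :
    Prop :=
  HasCoords (θ sl2S) (-1 / coordX) (algebraMap ℂ PlaneField Complex.I * coordY) ∧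
  ∃ φ t : Cremona, HasCoords φ coordX (coordY * ratSubst P coordX) ∧
    HasCoords t ((coordX - 1) / coordX) coordY ∧
    θ (sl2R * sl2S) = φ * t * φ⁻¹

/-!
Write `U = R S`, of order three in `SL(2, ℤ)`. The group `SL(2, ℤ)` is generated by `S` and `U`, with
the relations `S⁴ = U³ = 1` and `S²` central. This presentation (`exists_hom_of_relations`) gives the
morphism `θ`, as the two prescribed birational maps satisfy the same relations. It is proved with the
normal form `± U^a w S^b`, where `w` is a product of factors `S U` and `S U⁻¹`: up to a sign, such a
word `w` has positive diagonal and non-positive off-diagonal entries (`posWord_sign`), so that it has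
trace at least two in absolute value and is `±1` only if it is empty.

Every `θ(M)` is a triangular map `(M x, a(x) y)`, and the degree of such a map is, up to a bounded
error, the degree of the rational function `a` (`IsTriangular.degree_le`, `IsTriangular.degree`). The
latter is subadditive under composition, so that `deg θ(M)ⁿ` grows at most linearly. Triangularity
also gives the injectivity of `θ`: only `M = ±1` acts trivially on `x`, and `θ(-1) = (x, -y)`.

For the lower bound, an element of infinite order is conjugate, up to a sign, to a nonempty word `w`
(`exists_conj_posWord`), and conjugation changes the degree of `a` by a bounded amount. For a word
with `N` letters, `a` is a constant times the product of the `P(U^{±1} v x) / P(v x)`, where `v` runs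
over the proper tails of the word. Let `p` be a zero of `P`. As the zeros and poles of `P` lie on
distinct orbits and have no isotropy, along the orbit of `p` the function `P(g x)` has no pole and
vanishes only at `g⁻¹ p`, and the points `(U^{±1} v)⁻¹ p` and `v⁻¹ p` are pairwise distinct because
words have trace at least two in absolute value. So nothing cancels, and `a` has at least `N` zeros
(`exists_zeros_wordFactor`). Hence the growth is linear.
-/

open Polynomial
open scoped MatrixGroups

/-! ### Words and presentation of the modular group -/

/-- The word `∏ s u^{±1}` attached to a list of signs, `true` standing for `u` and `false` for
`u⁻¹`. -/
def posWord {Γ : Type*} [Group Γ] (s u : Γ) (l : List Bool) : Γ :=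
  (l.map fun e => s * if e then u else u⁻¹).prod

section Words

variable {Γ : Type*} [Group Γ] {s u : Γ}

@[simp] theorem posWord_nil : posWord s u [] = 1 := rfl

@[simp] theorem posWord_cons (e : Bool) (l : List Bool) :
    posWord s u (e :: l) = s * (if e then u else u⁻¹) * posWord s u l := by
  simp [posWord]

theorem posWord_append (l l' : List Bool) :
    posWord s u (l ++ l') = posWord s u l * posWord s u l' := by
  simp [posWord]

theorem map_posWord {Δ : Type*} [Group Δ] (f : Γ →* Δ) (l : List Bool) :
    f (posWord s u l) = posWord (f s) (f u) l := by
  induction l with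
  | nil => simp
  | cons e l ih => cases e <;> simp [ih]

theorem posWord_pow (l : List Bool) (n : ℕ) :
    ∃ l', l'.length = n * l.length ∧ posWord s u l' = posWord s u l ^ n := by
  induction n with
  | zero => exact ⟨[], by simp⟩
  | succ n ih =>
    obtain ⟨l', h, h'⟩ := ih
    exact ⟨l' ++ l, by rw [List.length_append, h]; ring, by rw [posWord_append, h', pow_succ]⟩

/-- The normal form `x = c · a · w · b`, with `c ∈ {1, s²}`, `a ∈ {1, u, u⁻¹}`, `b ∈ {1, s}` and `w`
a word in the `s u^{±1}`. -/
def HasNormalForm (s u x : Γ) : Prop :=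
  ∃ c a b l, (c = 1 ∨ c = s ^ 2) ∧ (a = 1 ∨ a = u ∨ a = u⁻¹) ∧ (b = 1 ∨ b = s) ∧
    x = c * a * posWord s u l * b

theorem HasNormalForm.sq_mul (hs : s ^ 4 = 1) {x : Γ} (h : HasNormalForm s u x) :
    HasNormalForm s u (s ^ 2 * x) := by
  obtain ⟨c, a, b, l, hc, ha, hb, rfl⟩ := h
  rcases hc with rfl | rfl
  · exact ⟨s ^ 2, a, b, l, .inr rfl, ha, hb, by group⟩
  · refine ⟨1, a, b, l, .inl rfl, ha, hb, ?_⟩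
    simp only [← mul_assoc, ← pow_add, hs]

theorem HasNormalForm.mul_u (hu : u ^ 3 = 1) (hsu : Commute (s ^ 2) u) {x : Γ}
    (h : HasNormalForm s u x) : HasNormalForm s u (u * x) := by
  obtain ⟨c, a, b, l, hc, ha, hb, rfl⟩ := h
  have hcu : u * c = c * u := by
    rcases hc with rfl | rfl
    · simp
    · exact hsu.eq.symm
  have huu : u * u = u⁻¹ := by rw [eq_inv_iff_mul_eq_one, ← hu, pow_succ, pow_two]
  refine ⟨c, u * a, b, l, hc, ?_, hb, by simp only [← mul_assoc, hcu]⟩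
  rcases ha with rfl | rfl | rfl <;> simp [huu]

theorem HasNormalForm.mul_s (hs : s ^ 4 = 1) {x : Γ} (hsu : Commute (s ^ 2) u)
    (h : HasNormalForm s u x) : HasNormalForm s u (s * x) := by
  obtain ⟨c, a, b, l, hc, ha, hb, rfl⟩ := h
  have key : HasNormalForm s u (s * (a * posWord s u l * b)) := by
    rcases ha with rfl | rfl | rfl
    · cases l with
      | nil =>
        rcases hb with rfl | rfl
        · exact ⟨1, 1, s, [], by simp, by simp, by simp, by simp⟩
        · exact ⟨b ^ 2, 1, 1, [], by simp, by simp, by simp, by simp [pow_two]⟩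
      | cons e l =>
        refine ⟨s ^ 2, if e then u else u⁻¹, b, l, .inr rfl, ?_, hb, ?_⟩
        · cases e <;> simp
        · simp [pow_two, mul_assoc]
    · exact ⟨1, 1, b, true :: l, by simp, by simp, hb, by simp [mul_assoc]⟩
    · exact ⟨1, 1, b, false :: l, by simp, by simp, hb, by simp [mul_assoc]⟩
  rcases hc with rfl | rfl
  · simpa using key
  · have : s * (s ^ 2 * a * posWord s u l * b) = s ^ 2 * (s * (a * posWord s u l * b)) := by group
    rw [this]
    exact key.sq_mul hs

theorem hasNormalForm_of_mem_closure (hs : s ^ 4 = 1) (hu : u ^ 3 = 1)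
    (hsu : Commute (s ^ 2) u) {x : Γ} (hx : x ∈ Subgroup.closure {s, u}) :
    HasNormalForm s u x := by
  have hsi : s⁻¹ = s * s * s := by
    rw [inv_eq_iff_mul_eq_one, ← hs, ← mul_assoc, ← mul_assoc]
    simp only [pow_succ, pow_zero, one_mul]
  have hui : u⁻¹ = u * u := by
    rw [inv_eq_iff_mul_eq_one, ← hu, ← mul_assoc]
    simp only [pow_succ, pow_zero, one_mul]
  induction hx using Subgroup.closure_induction_left with
  | one => exact ⟨1, 1, 1, [], by simp, by simp, by simp, by simp⟩
  | mul_left y hy x _ ih =>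
    rcases hy with rfl | rfl
    · exact ih.mul_s hs hsu
    · exact ih.mul_u hu hsu
  | inv_mul_cancel y hy x _ ih =>
    rcases hy with rfl | rfl
    · rw [hsi, mul_assoc, mul_assoc]
      exact ((ih.mul_s hs hsu).mul_s hs hsu).mul_s hs hsu
    · rw [hui, mul_assoc]
      exact (ih.mul_u hu hsu).mul_u hu hsu

/-- `x` has finite order, or is conjugate, up to a factor `s²`, to a nonempty word in the
`s u^{±1}`. -/
def IsTorsionOrConjWord (s u x : Γ) : Prop :=
  IsOfFinOrder x ∨ ∃ c g l, (c = 1 ∨ c = s ^ 2) ∧ l ≠ [] ∧ x = c * (g * posWord s u l * g⁻¹)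

theorem IsTorsionOrConjWord.conj (hcen : ∀ g, Commute (s ^ 2) g) {x : Γ} (g : Γ)
    (h : IsTorsionOrConjWord s u x) : IsTorsionOrConjWord s u (g * x * g⁻¹) := by
  rcases h with h | ⟨c, k, l, hc, hl, rfl⟩
  · left
    exact (MulAut.conj g).toMonoidHom.isOfFinOrder h
  · have hcg : g * c = c * g := by
      rcases hc with rfl | rfl
      · simp
      · exact (hcen g).eq.symm
    refine .inr ⟨c, g * k, l, hc, hl, ?_⟩
    rw [← mul_assoc, hcg]
    group

theorem IsTorsionOrConjWord.sq_mul (hs : s ^ 4 = 1) (hcen : ∀ g, Commute (s ^ 2) g) {x : Γ}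
    (h : IsTorsionOrConjWord s u x) : IsTorsionOrConjWord s u (s ^ 2 * x) := by
  rcases h with h | ⟨c, k, l, hc, hl, rfl⟩
  · left
    refine (hcen x).isOfFinOrder_mul ?_ h
    exact isOfFinOrder_iff_pow_eq_one.2 ⟨2, by norm_num, by rw [← pow_mul]; exact hs⟩
  · rcases hc with rfl | rfl
    · exact .inr ⟨s ^ 2, k, l, .inr rfl, hl, by group⟩
    · refine .inr ⟨1, k, l, .inl rfl, hl, ?_⟩
      rw [← mul_assoc, ← pow_add, hs]

/-- The reduction of a normal form by conjugation: the letters at the two ends of the word are brought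
together, and where they cancel the word gets shorter. -/
theorem isTorsionOrConjWord_aux (hs : s ^ 4 = 1) (hu : u ^ 3 = 1)
    (hcen : ∀ g, Commute (s ^ 2) g) (n : ℕ) : ∀ l : List Bool, l.length = n → ∀ a b : Γ,
    (a = 1 ∨ a = u ∨ a = u⁻¹) → (b = 1 ∨ b = s) →
      IsTorsionOrConjWord s u (a * posWord s u l * b) := by
  have hfs : IsOfFinOrder s := isOfFinOrder_iff_pow_eq_one.2 ⟨4, by norm_num, hs⟩
  have hfu : IsOfFinOrder u := isOfFinOrder_iff_pow_eq_one.2 ⟨3, by norm_num, hu⟩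
  have huu : u * u = u⁻¹ := by rw [eq_inv_iff_mul_eq_one, ← hu, pow_succ, pow_two]
  have huu' : u⁻¹ * u⁻¹ = u := by rw [← mul_inv_rev, huu, inv_inv]
  have hword : ∀ l, IsTorsionOrConjWord s u (posWord s u l) := by
    intro l
    by_cases hl : l = []
    · subst hl
      exact .inl (by simp)
    · exact .inr ⟨1, 1, l, .inl rfl, hl, by simp⟩
  induction n using Nat.strong_induction_on with
  | _ n ih =>
  intro l hln a b ha hb
  rcases hb with rfl | hb
  · by_cases ha1 : a = 1
    · subst ha1; simpa using hword l
    have ha' : ∃ e : Bool, a = if e then u else u⁻¹ := by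
      rcases ha with h | h | h
      · exact absurd h ha1
      · exact ⟨true, by simpa using h⟩
      · exact ⟨false, by simpa using h⟩
    obtain ⟨e, rfl⟩ := ha'
    rcases l.eq_nil_or_concat with rfl | ⟨l', e', rfl⟩
    · left
      cases e <;> simpa using hfu
    -- conjugate the last letter to the right and multiply it with the last letter of the word
    have hconj : (if e then u else u⁻¹) * posWord s u (l'.concat e') * 1 =
        (if e then u else u⁻¹) * (posWord s u l' * (s * ((if e' then u else u⁻¹) *
          if e then u else u⁻¹))) * (if e then u else u⁻¹)⁻¹ := by
      simp only [List.concat_eq_append, posWord_append, posWord_cons, posWord_nil]; group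
    rw [hconj]
    refine IsTorsionOrConjWord.conj hcen _ ?_
    by_cases hee : e' = e
    · subst hee
      have : posWord s u l' * (s * ((if e' then u else u⁻¹) * if e' then u else u⁻¹)) =
          posWord s u (l' ++ [!e']) := by
        cases e' <;> simp [posWord_append, huu, huu']
      rw [this]
      exact hword _
    -- the letters cancel
    · have : posWord s u l' * (s * ((if e' then u else u⁻¹) * if e then u else u⁻¹)) =
          1 * posWord s u l' * s := by
        cases e' <;> cases e <;> simp_all
      rw [this]
      exact ih l'.length (by rw [← hln]; simp) l' rfl 1 s (.inl rfl) (.inr rfl)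
  · rw [hb]
    by_cases ha1 : a = 1
    · subst ha1
      cases l with
      | nil => left; simpa using hfs
      | cons e l' =>
        have hconj : 1 * posWord s u (e :: l') * s =
            s⁻¹ * (s ^ 2 * ((if e then u else u⁻¹) * posWord s u l' * 1)) * s⁻¹⁻¹ := by
          simp [pow_two, mul_assoc]
        rw [hconj]
        refine IsTorsionOrConjWord.conj hcen _ (IsTorsionOrConjWord.sq_mul hs hcen ?_)
        exact ih l'.length (by rw [← hln]; simp) l' rfl _ 1 (by cases e <;> simp) (.inl rfl)
    have ha' : ∃ e : Bool, a = if e then u else u⁻¹ := by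
      rcases ha with h | h | h
      · exact absurd h ha1
      · exact ⟨true, by simpa using h⟩
      · exact ⟨false, by simpa using h⟩
    obtain ⟨e, rfl⟩ := ha'
    have hconj : (if e then u else u⁻¹) * posWord s u l * s =
        (if e then u else u⁻¹) * posWord s u (l ++ [e]) * (if e then u else u⁻¹)⁻¹ := by
      simp only [posWord_append, posWord_cons, posWord_nil]; group
    rw [hconj]
    exact IsTorsionOrConjWord.conj hcen _ (hword _)

theorem HasNormalForm.isTorsionOrConjWord (hs : s ^ 4 = 1) (hu : u ^ 3 = 1)
    (hcen : ∀ g, Commute (s ^ 2) g) {x : Γ} (h : HasNormalForm s u x) :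
    IsTorsionOrConjWord s u x := by
  obtain ⟨c, a, b, l, hc, ha, hb, rfl⟩ := h
  have := isTorsionOrConjWord_aux hs hu hcen _ l rfl a b ha hb
  rcases hc with rfl | rfl
  · simpa using this
  · simpa [mul_assoc] using this.sq_mul hs hcen

end Words

/-- The element `R S` of order three of `SL(2, ℤ)`. -/
def sl2U : SL(2, ℤ) := sl2R * sl2S

theorem coe_sl2U : (sl2U : Matrix (Fin 2) (Fin 2) ℤ) = !![-1, 1; -1, 0] := by
  decide

theorem coe_sl2U_inv : ((sl2U⁻¹ : SL(2, ℤ)) :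
    Matrix (Fin 2) (Fin 2) ℤ) = !![0, -1; 1, -1] := by
  decide

theorem coe_sl2S : (sl2S : Matrix (Fin 2) (Fin 2) ℤ) = !![0, 1; -1, 0] := rfl

theorem sl2S_sq : sl2S ^ 2 = -1 := by
  decide

theorem sl2S_pow_four : sl2S ^ 4 = 1 := by
  rw [show 4 = 2 * 2 from rfl, pow_mul, sl2S_sq]; simp

theorem sl2U_pow_three : sl2U ^ 3 = 1 := by
  decide

theorem closure_sl2S_sl2U : Subgroup.closure {sl2S, sl2U} = ⊤ := by
  rw [eq_top_iff, ← SpecialLinearGroup.SL2Z_generators, Subgroup.closure_le]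
  have hS : sl2S ∈ Subgroup.closure {sl2S, sl2U} := Subgroup.subset_closure (by simp)
  have hU : sl2U ∈ Subgroup.closure {sl2S, sl2U} := Subgroup.subset_closure (by simp)
  rintro x (rfl | rfl)
  · have : ModularGroup.S = sl2S⁻¹ := by decide
    rw [this]
    exact inv_mem hS
  · have : ModularGroup.T = sl2U * sl2S⁻¹ := by
      rw [sl2U, mul_inv_cancel_right]; rfl
    rw [this]
    exact mul_mem hU (inv_mem hS)

/-- Up to a sign, a word in the `S U^{±1}` has positive diagonal and non-positive off-diagonal
entries. -/
theorem posWord_sign (l : List Bool) : ∃ σ : ℤ, (σ = 1 ∨ σ = -1) ∧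
    1 ≤ σ * (posWord sl2S sl2U l) 0 0 ∧ 1 ≤ σ * (posWord sl2S sl2U l) 1 1 ∧
    σ * (posWord sl2S sl2U l) 0 1 ≤ 0 ∧ σ * (posWord sl2S sl2U l) 1 0 ≤ 0 ∧
    (l ≠ [] → σ * (posWord sl2S sl2U l) 0 1 + σ * (posWord sl2S sl2U l) 1 0 < 0) := by
  induction l with
  | nil => exact ⟨1, by simp⟩
  | cons e l ih =>
    obtain ⟨σ, hσ, h00, h11, h01, h10, -⟩ := ih
    generalize hM : posWord sl2S sl2U l = M at *
    cases e
    · refine ⟨σ, hσ, ?_⟩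
      simp only [posWord_cons, hM, Matrix.SpecialLinearGroup.coe_mul, coe_sl2S, coe_sl2U_inv,
        Bool.false_eq_true, if_false]
      simp [Matrix.mul_apply, Fin.sum_univ_two, mul_add]
      omega
    · refine ⟨-σ, by omega, ?_⟩
      simp only [posWord_cons, hM, Matrix.SpecialLinearGroup.coe_mul, coe_sl2S, coe_sl2U,
        if_true]
      simp [Matrix.mul_apply, Fin.sum_univ_two, mul_add]
      omega

theorem eq_nil_of_posWord_eq {l : List Bool} {c : SL(2, ℤ)}
    (hc : c = 1 ∨ c = -1) (h : posWord sl2S sl2U l = c) : l = [] := by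
  obtain ⟨σ, hσ, -, -, -, -, h0⟩ := posWord_sign l
  by_contra hl
  have := h0 hl
  rw [h] at this
  rcases hc with rfl | rfl <;> simp at this

/-- A word in the `S U^{±1}` has trace at least two in absolute value, `U^{±1}` has trace `-1`. -/
theorem posWord_ne_sl2U {l : List Bool} {c a : SL(2, ℤ)}
    (hc : c = 1 ∨ c = -1) (ha : a = sl2U ∨ a = sl2U⁻¹) : posWord sl2S sl2U l ≠ c * a := by
  intro h
  obtain ⟨σ, hσ, h00, h11, -⟩ := posWord_sign l
  rw [h] at h00 h11
  rcases hc with rfl | rfl <;> rcases ha with rfl | rfl <;>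
    simp [coe_sl2U] at h00 h11

theorem hasNormalForm_sl2 (M : SL(2, ℤ)) :
    HasNormalForm sl2S sl2U M :=
  hasNormalForm_of_mem_closure sl2S_pow_four sl2U_pow_three (by rw [sl2S_sq]; simp)
    (closure_sl2S_sl2U ▸ Subgroup.mem_top M)

/-- The normal form of the identity matrix is the trivial one. -/
theorem eq_one_of_normalForm_eq_one {c a b : SL(2, ℤ)} {l : List Bool}
    (hc : c = 1 ∨ c = -1) (ha : a = 1 ∨ a = sl2U ∨ a = sl2U⁻¹) (hb : b = 1 ∨ b = sl2S)
    (h : c * a * posWord sl2S sl2U l * b = 1) : c = 1 ∧ a = 1 ∧ b = 1 ∧ l = [] := by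
  have h' : posWord sl2S sl2U l = a⁻¹ * c⁻¹ * b⁻¹ := by
    have h2 : posWord sl2S sl2U l = a⁻¹ * c⁻¹ * (c * a * posWord sl2S sl2U l * b) * b⁻¹ := by
      group
    rwa [h, mul_one] at h2
  obtain ⟨σ, hσ, h00, h11, h01, h10, -⟩ := posWord_sign l
  by_cases hab : a = 1 ∧ b = 1
  · obtain ⟨rfl, rfl⟩ := hab
    have hl : l = [] := eq_nil_of_posWord_eq (c := c⁻¹) (by rcases hc with rfl | rfl <;> simp)
      (by simpa using h')
    subst hl
    exact ⟨by simpa using h, rfl, rfl, rfl⟩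
  · exfalso
    rw [h'] at h00 h11 h01 h10
    clear h h'
    revert hab h00 h11 h01 h10
    rcases hc with rfl | rfl <;> rcases ha with rfl | rfl | rfl <;> rcases hb with rfl | rfl <;>
      rcases hσ with rfl | rfl <;> decide

/-- The presentation `⟨s, u ∣ s⁴ = u³ = [s², u] = 1⟩` of `SL(2, ℤ)`: normal forms in the subgroup of
`SL(2, ℤ) × G` generated by `(S, s)` and `(U, u)` show that this subgroup is the graph of a
morphism. -/
theorem exists_hom_of_relations {G : Type*} [Group G] {s u : G} (hs : s ^ 4 = 1) (hu : u ^ 3 = 1)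
    (hsu : Commute (s ^ 2) u) :
    ∃ θ : SL(2, ℤ) →* G, θ sl2S = s ∧ θ sl2U = u := by
  let H : Subgroup (SL(2, ℤ) × G) :=
    Subgroup.closure {(sl2S, s), (sl2U, u)}
  have hS : (sl2S, s) ∈ H := Subgroup.subset_closure (by simp)
  have hU : (sl2U, u) ∈ H := Subgroup.subset_closure (by simp)
  let π : H →* SL(2, ℤ) := (MonoidHom.fst _ _).comp H.subtype
  have hinj : Function.Injective π := by
    rw [injective_iff_map_eq_one]
    rintro ⟨x, hx⟩ hx1
    obtain ⟨c, a, b, l, hc, ha, hb, rfl⟩ := hasNormalForm_of_mem_closure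
      (s := (sl2S, s)) (u := (sl2U, u)) (by simp [hs, sl2S_pow_four])
      (by simp [hu, sl2U_pow_three]) (by
        rw [Prod.pow_mk, sl2S_sq]
        exact Prod.ext (by simp) hsu.eq) hx
    have h1 : c.1 * a.1 * posWord sl2S sl2U l * b.1 = 1 := by
      have := map_posWord (MonoidHom.fst (SL(2, ℤ)) G)
        (s := (sl2S, s)) (u := (sl2U, u)) l
      simp only [MonoidHom.coe_fst] at this
      simpa [π, this] using hx1
    obtain ⟨hc1, ha1, hb1, rfl⟩ := eq_one_of_normalForm_eq_one
      (by rcases hc with rfl | rfl <;> simp [sl2S_sq])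
      (by rcases ha with rfl | rfl | rfl <;> simp) (by rcases hb with rfl | rfl <;> simp) h1
    have hS2 : sl2S ^ 2 ≠ 1 := by decide
    have hS1 : sl2S ≠ 1 := by decide
    have hU1 : sl2U ≠ 1 := by decide
    have hc' : c = 1 := hc.resolve_right fun h => hS2 (by rw [← hc1, h, Prod.pow_fst])
    have ha' : a = 1 := by
      rcases ha with rfl | rfl | rfl
      · rfl
      · exact absurd ha1 hU1
      · exact absurd (inv_eq_one.1 ha1) hU1
    have hb' : b = 1 := hb.resolve_right fun h => hS1 (by rw [← hb1, h])
    simp [hc', ha', hb']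
  have hsurj : Function.Surjective π := by
    rw [← MonoidHom.range_eq_top, eq_top_iff, ← closure_sl2S_sl2U, Subgroup.closure_le]
    rintro x (rfl | rfl)
    · exact ⟨⟨_, hS⟩, rfl⟩
    · exact ⟨⟨_, hU⟩, rfl⟩
  let e := MulEquiv.ofBijective π ⟨hinj, hsurj⟩
  have he : ∀ x : H, e.symm x.1.1 = x := fun x => e.symm_apply_apply x
  refine ⟨((MonoidHom.snd _ _).comp H.subtype).comp e.symm.toMonoidHom, ?_, ?_⟩
  · have := he ⟨_, hS⟩
    simp only at this
    simp [this]
  · have := he ⟨_, hU⟩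
    simp only at this
    simp [this]

/-- An element of infinite order of `SL(2, ℤ)` is conjugate, up to sign, to a nonempty word in the
`S U^{±1}`. -/
theorem exists_conj_posWord {M : SL(2, ℤ)} (hM : ¬ IsOfFinOrder M) :
    ∃ c g l, (c = 1 ∨ c = -1) ∧ l ≠ [] ∧ M = c * (g * posWord sl2S sl2U l * g⁻¹) := by
  have := ((hasNormalForm_sl2 M).isTorsionOrConjWord sl2S_pow_four sl2U_pow_three
    (by intro g; rw [sl2S_sq]; simp)).resolve_left hM
  rwa [sl2S_sq] at this

theorem eq_one_or_neg_one_of_entries {M : SL(2, ℤ)} (h10 : M 1 0 = 0)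
    (h01 : M 0 1 = 0) (h : M 0 0 = M 1 1) : M = 1 ∨ M = -1 := by
  have hd := M.det_coe
  rw [Matrix.det_fin_two, h10, h, mul_zero, sub_zero, mul_self_eq_one_iff] at hd
  rcases hd with hd | hd
  · left
    ext i j
    fin_cases i <;> fin_cases j <;> simp_all
  · right
    ext i j
    fin_cases i <;> fin_cases j <;> simp_all

/-! ### Birational maps with given coordinates -/

theorem pullback_mul_apply (f g : Cremona) (q : PlaneField) :
    pullback (f * g) q = pullback g (pullback f q) := rfl

@[simp] theorem pullback_one_apply (q : PlaneField) : pullback 1 q = q := rfl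

theorem pullback_inv_pullback (f : Cremona) (q : PlaneField) :
    pullback f⁻¹ (pullback f q) = q := f.unop.symm_apply_apply q

theorem cremona_ext {f g : Cremona} (hx : pullback f coordX = pullback g coordX)
    (hy : pullback f coordY = pullback g coordY) : f = g := by
  apply MulOpposite.unop_injective
  apply AlgEquiv.coe_toAlgHom_injective
  refine IsLocalization.algHom_ext (nonZeroDivisors (MvPolynomial (Fin 2) ℂ)) ?_
  ext i
  fin_cases i
  · exact hx
  · exact hy

theorem two_le_trdeg_planeField : 2 ≤ Algebra.trdeg ℂ PlaneField := by
  have h := trdeg_le_of_injective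
    (IsScalarTower.toAlgHom ℂ (MvPolynomial (Fin 2) ℂ) PlaneField)
    (IsFractionRing.injective (MvPolynomial (Fin 2) ℂ) PlaneField)
  simpa using h

theorem adjoin_coords_eq_top : IntermediateField.adjoin ℂ {coordX, coordY} = ⊤ := by
  rw [eq_top_iff]
  rintro q -
  have hmem : ∀ p : MvPolynomial (Fin 2) ℂ,
      algebraMap _ PlaneField p ∈ IntermediateField.adjoin ℂ {coordX, coordY} := by
    intro p
    induction p using MvPolynomial.induction_on with
    | C a =>
      rw [← MvPolynomial.algebraMap_eq, ← IsScalarTower.algebraMap_apply]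
      exact IntermediateField.algebraMap_mem _ a
    | add p q hp hq => rw [map_add]; exact add_mem hp hq
    | mul_X p i hp =>
      rw [map_mul]
      refine mul_mem hp (IntermediateField.subset_adjoin _ _ ?_)
      fin_cases i
      · exact .inl rfl
      · exact .inr rfl
  obtain ⟨a, b, -, rfl⟩ := IsFractionRing.div_surjective (A := MvPolynomial (Fin 2) ℂ) q
  exact div_mem (hmem a) (hmem b)

/-- Two rational functions that generate `ℂ(x, y)` are the coordinates of a birational map: they
are algebraically independent, as the transcendence degree is two. -/
theorem exists_hasCoords {A B : PlaneField}
    (hx : coordX ∈ IntermediateField.adjoin ℂ {A, B})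
    (hy : coordY ∈ IntermediateField.adjoin ℂ {A, B}) : ∃ f : Cremona, HasCoords f A B := by
  have hr : Set.range ![A, B] = {A, B} := by simp [Set.pair_comm]
  have htop : IntermediateField.adjoin ℂ (Set.range ![A, B]) = ⊤ := by
    rw [hr, eq_top_iff, ← adjoin_coords_eq_top, IntermediateField.adjoin_le_iff]
    rintro q (rfl | rfl)
    · exact hx
    · exact hy
  have halg : Algebra.IsAlgebraic (Algebra.adjoin ℂ (Set.range ![A, B])) PlaneField := by
    refine ⟨fun q => ?_⟩
    have hq : q ∈ IntermediateField.adjoin ℂ (Set.range ![A, B]) := htop ▸ trivial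
    obtain ⟨r, hr, s, hs, rfl⟩ := IntermediateField.mem_adjoin_iff_div.1 hq
    have h1 : IsAlgebraic (Algebra.adjoin ℂ (Set.range ![A, B])) r :=
      isAlgebraic_algebraMap (⟨r, hr⟩ : Algebra.adjoin ℂ (Set.range ![A, B]))
    have h2 : IsAlgebraic (Algebra.adjoin ℂ (Set.range ![A, B])) s :=
      isAlgebraic_algebraMap (⟨s, hs⟩ : Algebra.adjoin ℂ (Set.range ![A, B]))
    rw [div_eq_mul_inv]
    exact h1.mul h2.inv
  have hind : AlgebraicIndependent ℂ ![A, B] :=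
    (Algebra.IsAlgebraic.isTranscendenceBasis_of_le_trdeg_of_finite ℂ ![A, B]
      (by simpa using two_le_trdeg_planeField)).1
  let e : PlaneField ≃ₐ[ℂ] PlaneField := hind.aevalEquivField.trans
    ((IntermediateField.equivOfEq htop).trans IntermediateField.topEquiv)
  have he : ∀ p, e (algebraMap _ _ p) = MvPolynomial.aeval ![A, B] p := fun p =>
    hind.aevalEquivField_algebraMap_apply_coe p
  refine ⟨MulOpposite.op e, ?_, ?_⟩
  · exact (he _).trans (by simp)
  · exact (he _).trans (by simp)

/-! ### Rational functions of `x` -/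

/-- The rational function `p(x)` of the plane attached to a polynomial `p`. -/
noncomputable def polyX : ℂ[X] →ₐ[ℂ] PlaneField := aeval coordX

theorem polyX_injective : Function.Injective polyX := by
  have h : (polyX : ℂ[X] → PlaneField) =
      (algebraMap (MvPolynomial (Fin 2) ℂ) PlaneField) ∘ (aeval (MvPolynomial.X 0)) := by
    ext p
    have : polyX = (IsScalarTower.toAlgHom ℂ (MvPolynomial (Fin 2) ℂ) PlaneField).comp
        (aeval (MvPolynomial.X 0)) := by
      ext; simp [polyX, coordX]
    rw [this]; rfl
  rw [h]
  refine (IsFractionRing.injective _ _).comp ?_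
  exact (transcendental_iff_injective.1 (MvPolynomial.transcendental_X ℂ 0))

theorem polyX_ne_zero {p : ℂ[X]} (hp : p ≠ 0) : polyX p ≠ 0 :=
  (map_ne_zero_iff _ polyX_injective).2 hp

@[simp] theorem polyX_X : polyX X = coordX := by simp [polyX]

@[simp] theorem polyX_C (a : ℂ) : polyX (C a) = algebraMap ℂ PlaneField a := by
  simp [polyX]

theorem coordX_ne_zero : coordX ≠ 0 := by
  rw [← polyX_X]; exact polyX_ne_zero X_ne_zero

theorem coordY_ne_zero : coordY ≠ 0 := by
  rw [coordY, Ne, FaithfulSMul.algebraMap_eq_zero_iff]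
  exact MvPolynomial.X_ne_zero _

/-- The Möbius transform `(a t + b) / (c t + d)` of `t ∈ ℂ(x, y)`. -/
noncomputable def mob (M : SL(2, ℤ)) (t : PlaneField) : PlaneField :=
  ((M 0 0 : ℤ) * t + (M 0 1 : ℤ)) / ((M 1 0 : ℤ) * t + (M 1 1 : ℤ))

theorem linear_ne_zero {a b : ℤ} (h : a ≠ 0 ∨ b ≠ 0) : (a : ℂ[X]) * X + (b : ℂ[X]) ≠ 0 := by
  intro h0
  have h1 := congrArg (eval 0) h0
  have h2 := congrArg (eval 1) h0
  simp at h1 h2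
  norm_cast at h2
  omega

theorem sl2_row_ne_zero (M : SL(2, ℤ)) (i : Fin 2) : M i 0 ≠ 0 ∨ M i 1 ≠ 0 := by
  by_contra! h
  have hd := M.det_coe
  rw [Matrix.det_fin_two] at hd
  fin_cases i <;> simp_all

theorem coordX_row_ne_zero (M : SL(2, ℤ)) (i : Fin 2) :
    ((M i 0 : ℤ) : PlaneField) * coordX + ((M i 1 : ℤ) : PlaneField) ≠ 0 := by
  simpa using polyX_ne_zero (linear_ne_zero (sl2_row_ne_zero M i))

theorem mob_mob (M N : SL(2, ℤ)) : mob M (mob N coordX) = mob (M * N) coordX := by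
  have h1 := coordX_row_ne_zero N 1
  simp only [mob]
  have key : ∀ i : Fin 2, ((M i 0 : ℤ) : PlaneField) * (((N 0 0 : ℤ) * coordX + (N 0 1 : ℤ)) /
      ((N 1 0 : ℤ) * coordX + (N 1 1 : ℤ))) + ((M i 1 : ℤ) : PlaneField) =
      (((M * N) i 0 : ℤ) * coordX + ((M * N) i 1 : ℤ)) /
        ((N 1 0 : ℤ) * coordX + (N 1 1 : ℤ)) := by
    intro i
    rw [eq_div_iff h1, add_mul, mul_assoc, div_mul_cancel₀ _ h1]
    simp [Matrix.mul_apply, Fin.sum_univ_two]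
    ring
  rw [key 0, key 1]
  rw [div_div_div_cancel_right₀ h1]

theorem pullback_mob (f : Cremona) (M : SL(2, ℤ)) (t : PlaneField) :
    pullback f (mob M t) = mob M (pullback f t) := by
  simp [mob]

theorem pullback_ratSubst (f : Cremona) (P : RatFunc ℂ) (t : PlaneField) :
    pullback f (ratSubst P t) = ratSubst P (pullback f t) := by
  have h : ∀ p : ℂ[X], pullback f (eval₂ (algebraMap ℂ PlaneField) t p) =
      eval₂ (algebraMap ℂ PlaneField) (pullback f t) p := by
    intro p
    rw [← aeval_def, ← aeval_def]
    exact (aeval_algHom_apply (pullback f) t p).symm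
  simp [ratSubst, RatFunc.eval, h]

@[simp] theorem mob_one (t : PlaneField) : mob 1 t = t := by simp [mob]

@[simp] theorem mob_neg (M : SL(2, ℤ)) (t : PlaneField) : mob (-M) t = mob M t := by
  simp only [mob, Matrix.SpecialLinearGroup.coe_neg, Matrix.neg_apply]
  rw [← neg_div_neg_eq]
  congr 1 <;> push_cast <;> ring

theorem mob_sl2S (t : PlaneField) : mob sl2S t = -1 / t := by
  simp [mob, coe_sl2S, div_eq_mul_inv]

theorem mob_sl2U {t : PlaneField} : mob sl2U t = (t - 1) / t := by
  simp only [mob, coe_sl2U]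
  rw [← neg_div_neg_eq]
  simp
  ring

theorem eq_one_or_neg_one_of_mob_eq {M : SL(2, ℤ)} (h : mob M coordX = coordX) :
    M = 1 ∨ M = -1 := by
  rw [mob, div_eq_iff (coordX_row_ne_zero M 1)] at h
  have h2 : polyX (((M 0 0 : ℤ) : ℂ[X]) * X + ((M 0 1 : ℤ) : ℂ[X])) =
      polyX (X * (((M 1 0 : ℤ) : ℂ[X]) * X + ((M 1 1 : ℤ) : ℂ[X]))) := by simp [h]
  have h3 := polyX_injective h2
  have c0 := congrArg (eval 0) h3
  have c1 := congrArg (eval 1) h3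
  have c2 := congrArg (eval (-1)) h3
  simp at c0 c1 c2
  norm_cast at c1 c2
  exact eq_one_or_neg_one_of_entries (by omega) c0 (by omega)

/-! ### The morphism -/

theorem ratSubst_coordX (P : RatFunc ℂ) : ratSubst P coordX = polyX P.num / polyX P.denom := rfl

theorem ratSubst_coordX_ne_zero {P : RatFunc ℂ} (hP : P ≠ 0) : ratSubst P coordX ≠ 0 :=
  div_ne_zero (polyX_ne_zero (RatFunc.num_ne_zero hP)) (polyX_ne_zero P.denom_ne_zero)

theorem polyX_mem_adjoin (p : ℂ[X]) {S : Set PlaneField} (h : coordX ∈ S) :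
    polyX p ∈ IntermediateField.adjoin ℂ S :=
  IntermediateField.algebra_adjoin_le_adjoin ℂ S
    (Algebra.adjoin_mono (Set.singleton_subset_iff.2 h) (aeval_mem_adjoin_singleton ℂ coordX))

/-- The map `φ = (x, y P(x))`. -/
theorem exists_twist {P : RatFunc ℂ} (hP : P ≠ 0) :
    ∃ φ : Cremona, HasCoords φ coordX (coordY * ratSubst P coordX) := by
  have hX : ∀ B, coordX ∈ IntermediateField.adjoin ℂ {coordX, B} := fun B =>
    IntermediateField.subset_adjoin _ _ (.inl rfl)
  refine exists_hasCoords (hX _) ?_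
  have h2 := IntermediateField.subset_adjoin ℂ
    ({coordX, coordY * ratSubst P coordX} : Set PlaneField) (.inr rfl)
  have hr : ratSubst P coordX ∈
      IntermediateField.adjoin ℂ {coordX, coordY * ratSubst P coordX} :=
    div_mem (polyX_mem_adjoin _ (.inl rfl)) (polyX_mem_adjoin _ (.inl rfl))
  have h3 := div_mem h2 hr
  rwa [mul_div_cancel_right₀ _ (ratSubst_coordX_ne_zero hP)] at h3

/-- The map `((x - 1) / x, y)`. -/
theorem exists_rotation : ∃ t : Cremona, HasCoords t ((coordX - 1) / coordX) coordY := by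
  refine exists_hasCoords ?_ (IntermediateField.subset_adjoin _ _ (.inr rfl))
  have h1 := IntermediateField.subset_adjoin ℂ
    ({(coordX - 1) / coordX, coordY} : Set PlaneField) (.inl rfl)
  have : coordX = 1 / (1 - (coordX - 1) / coordX) := by
    have := coordX_ne_zero
    field_simp
    ring
  rw [this]
  exact div_mem (one_mem _) (sub_mem (one_mem _) (by rwa [← this]))

/-- The map `(-1 / x, i y)`. -/
theorem exists_quarterTurn : ∃ s : Cremona,
    HasCoords s (-1 / coordX) (algebraMap ℂ PlaneField Complex.I * coordY) := by
  have hI : algebraMap ℂ PlaneField Complex.I ≠ 0 := by simp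
  refine exists_hasCoords ?_ ?_
  · have h1 := IntermediateField.subset_adjoin ℂ
      ({-1 / coordX, algebraMap ℂ PlaneField Complex.I * coordY} : Set PlaneField) (.inl rfl)
    have : coordX = -1 / (-1 / coordX) := by
      have := coordX_ne_zero
      field_simp
    rw [this]
    exact div_mem (neg_mem (one_mem _)) (by rwa [← this])
  · have h1 := IntermediateField.subset_adjoin ℂ
      ({-1 / coordX, algebraMap ℂ PlaneField Complex.I * coordY} : Set PlaneField) (.inr rfl)
    have h2 := div_mem h1 (IntermediateField.algebraMap_mem _ Complex.I)
    rwa [mul_div_cancel_left₀ _ hI] at h2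

section Morphism

variable {P : RatFunc ℂ} {s φ t : Cremona}

/-- The conjugate of the rotation `t` by the twist `φ` is `((x - 1) / x, y P((x - 1) / x) / P(x))`. -/
theorem hasCoords_conj (hP : P ≠ 0) (hφ : HasCoords φ coordX (coordY * ratSubst P coordX))
    (ht : HasCoords t ((coordX - 1) / coordX) coordY) :
    HasCoords (φ * t * φ⁻¹) (mob sl2U coordX)
      (ratSubst P (mob sl2U coordX) / ratSubst P coordX * coordY) := by
  have h1 : pullback φ⁻¹ coordX = coordX := by
    conv_lhs => rw [← hφ.1]
    exact pullback_inv_pullback φ coordX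
  have h2 : pullback φ⁻¹ coordY = coordY / ratSubst P coordX := by
    have := pullback_inv_pullback φ coordY
    rw [hφ.2, map_mul, pullback_ratSubst, h1] at this
    rw [eq_div_iff (ratSubst_coordX_ne_zero hP), this]
  have h3 : pullback t coordX = mob sl2U coordX := by rw [ht.1, mob_sl2U]
  constructor
  · rw [pullback_mul_apply, pullback_mul_apply, hφ.1, h3, pullback_mob, h1]
  · rw [pullback_mul_apply, pullback_mul_apply, hφ.2, map_mul, ht.2, pullback_ratSubst, h3,
      map_mul, pullback_ratSubst, pullback_mob, h1, h2]
    ring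

theorem rotation_pow_three (ht : HasCoords t ((coordX - 1) / coordX) coordY) : t ^ 3 = 1 := by
  have h3 : pullback t coordX = mob sl2U coordX := by rw [ht.1, mob_sl2U]
  have hU : sl2U * sl2U * sl2U = 1 := by decide
  apply cremona_ext
  · simp only [pow_succ, pow_zero, one_mul, pullback_mul_apply, h3, pullback_mob, mob_mob,
      pullback_one_apply, hU, mob_one]
  · simp only [pow_succ, pow_zero, one_mul, pullback_mul_apply, ht.2, pullback_one_apply]

theorem quarterTurn_sq
    (hs : HasCoords s (-1 / coordX) (algebraMap ℂ PlaneField Complex.I * coordY)) :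
    HasCoords (s ^ 2) coordX (-coordY) := by
  have h1 : pullback s coordX = mob sl2S coordX := by rw [hs.1, mob_sl2S]
  have hS : sl2S * sl2S = -1 := by decide
  constructor
  · rw [pow_two, pullback_mul_apply, h1, pullback_mob, h1, mob_mob, hS, mob_neg, mob_one]
  · rw [pow_two, pullback_mul_apply, hs.2, map_mul, hs.2, AlgEquiv.commutes, ← mul_assoc,
      ← map_mul, Complex.I_mul_I, map_neg, map_one, neg_one_mul]

theorem quarterTurn_pow_four
    (hs : HasCoords s (-1 / coordX) (algebraMap ℂ PlaneField Complex.I * coordY)) :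
    s ^ 4 = 1 := by
  obtain ⟨h1, h2⟩ := quarterTurn_sq hs
  rw [show 4 = 2 * 2 from rfl, pow_mul, pow_two (s ^ 2)]
  apply cremona_ext
  · rw [pullback_mul_apply, h1, h1, pullback_one_apply]
  · rw [pullback_mul_apply, h2, map_neg, h2, neg_neg, pullback_one_apply]

theorem commute_quarterTurn_sq (hP : P ≠ 0)
    (hs : HasCoords s (-1 / coordX) (algebraMap ℂ PlaneField Complex.I * coordY))
    (hφ : HasCoords φ coordX (coordY * ratSubst P coordX))
    (ht : HasCoords t ((coordX - 1) / coordX) coordY) :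
    Commute (s ^ 2) (φ * t * φ⁻¹) := by
  obtain ⟨h1, h2⟩ := quarterTurn_sq hs
  obtain ⟨h3, h4⟩ := hasCoords_conj hP hφ ht
  generalize φ * t * φ⁻¹ = u at *
  apply cremona_ext
  · rw [pullback_mul_apply, pullback_mul_apply, h1, h3, pullback_mob, h1]
  · rw [pullback_mul_apply, pullback_mul_apply, h2, map_neg, h4, map_mul, map_div₀,
      pullback_ratSubst, pullback_ratSubst, pullback_mob, h1, h2, mul_neg]

theorem existsUnique_twistedMorphism (hP : P ≠ 0) :
    ∃! θ : SL(2, ℤ) →* Cremona, IsTwistedMorphism P θ := by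
  obtain ⟨φ, hφ⟩ := exists_twist hP
  obtain ⟨t, ht⟩ := exists_rotation
  obtain ⟨s, hs⟩ := exists_quarterTurn
  obtain ⟨θ, hθS, hθU⟩ := exists_hom_of_relations (u := φ * t * φ⁻¹) (quarterTurn_pow_four hs)
    (by rw [conj_pow, rotation_pow_three ht]; simp) (commute_quarterTurn_sq hP hs hφ ht)
  refine ⟨θ, ⟨by rwa [hθS], φ, t, hφ, ht, hθU⟩, ?_⟩
  rintro θ' ⟨hs', φ', t', hφ', ht', hθU'⟩
  obtain rfl : φ' = φ := cremona_ext (hφ'.1.trans hφ.1.symm) (hφ'.2.trans hφ.2.symm)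
  obtain rfl : t' = t := cremona_ext (ht'.1.trans ht.1.symm) (ht'.2.trans ht.2.symm)
  refine MonoidHom.eq_of_eqOn_dense closure_sl2S_sl2U ?_
  rintro x (rfl | rfl)
  · rw [hθS]
    exact cremona_ext (hs'.1.trans hs.1.symm) (hs'.2.trans hs.2.symm)
  · exact hθU'.trans hθU.symm

end Morphism

/-! ### Homogeneous evaluation -/

/-- The value `∑ p_i A^i B^(k-i)` at `(A, B)` of the homogenization in degree `k` of `p`. -/
noncomputable def homEval {R : Type*} [CommRing R] [Algebra ℂ R] (k : ℕ) (p : ℂ[X]) (A B : R) : R :=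
  ∑ i ∈ Finset.range (k + 1), p.coeff i • (A ^ i * B ^ (k - i))

theorem map_homEval {R S : Type*} [CommRing R] [Algebra ℂ R] [CommRing S] [Algebra ℂ S]
    (f : R →ₐ[ℂ] S) (k : ℕ) (p : ℂ[X]) (A B : R) :
    f (homEval k p A B) = homEval k p (f A) (f B) := by
  simp [homEval]

theorem homEval_eq_aeval_mul {K : Type*} [Field K] [Algebra ℂ K] {k : ℕ} {p : ℂ[X]}
    (hp : p.natDegree ≤ k) (A : K) {B : K} (hB : B ≠ 0) :
    homEval k p A B = aeval (A / B) p * B ^ k := by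
  rw [aeval_eq_sum_range' (Nat.lt_succ_of_le hp), homEval, Finset.sum_mul]
  refine Finset.sum_congr rfl fun i hi => ?_
  have hik : i ≤ k := Nat.lt_succ_iff.1 (Finset.mem_range.1 hi)
  rw [smul_mul_assoc, div_pow, div_mul_eq_mul_div, mul_div_assoc, pow_sub₀ _ hB hik,
    div_eq_mul_inv]

theorem homEval_one {R : Type*} [CommRing R] [Algebra ℂ R] {k : ℕ} {p : ℂ[X]}
    (hp : p.natDegree ≤ k) (A : R) : homEval k p A 1 = aeval A p := by
  simp [homEval, aeval_eq_sum_range' (Nat.lt_succ_of_le hp)]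

theorem natDegree_homEval_le (k : ℕ) (p : ℂ[X]) {A B : ℂ[X]} (hA : A.natDegree ≤ 1)
    (hB : B.natDegree ≤ 1) : (homEval k p A B).natDegree ≤ k := by
  refine natDegree_sum_le_of_forall_le _ _ fun i hi => ?_
  have hik : i ≤ k := Nat.lt_succ_iff.1 (Finset.mem_range.1 hi)
  refine (natDegree_smul_le _ _).trans (natDegree_mul_le.trans ?_)
  have h1 := natDegree_pow_le_of_le i hA
  have h2 := natDegree_pow_le_of_le (k - i) hB
  omega

theorem isHomogeneous_homEval {σ : Type*} (k : ℕ) (p : ℂ[X]) {A B : MvPolynomial σ ℂ}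
    (hA : A.IsHomogeneous 1) (hB : B.IsHomogeneous 1) : (homEval k p A B).IsHomogeneous k := by
  refine MvPolynomial.IsHomogeneous.sum _ _ _ fun i hi => ?_
  have hik : i ≤ k := Nat.lt_succ_iff.1 (Finset.mem_range.1 hi)
  rw [MvPolynomial.smul_eq_C_mul]
  have := ((hA.pow i).mul (hB.pow (k - i))).C_mul (p.coeff i)
  rwa [one_mul, one_mul, Nat.add_sub_cancel' hik] at this

/-- The numerator of `p ((a x + b) / (c x + d))` over the denominator `(c x + d) ^ k`. -/
noncomputable def mobNumer (M : SL(2, ℤ)) (k : ℕ) (p : ℂ[X]) : ℂ[X] :=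
  homEval k p (((M 0 0 : ℤ) : ℂ[X]) * X + ((M 0 1 : ℤ) : ℂ[X]))
    (((M 1 0 : ℤ) : ℂ[X]) * X + ((M 1 1 : ℤ) : ℂ[X]))

theorem natDegree_mobNumer_le (M : SL(2, ℤ)) (k : ℕ) (p : ℂ[X]) :
    (mobNumer M k p).natDegree ≤ k := by
  have h : ∀ a b : ℤ, ((a : ℂ[X]) * X + (b : ℂ[X])).natDegree ≤ 1 := fun a b => by
    rw [← C_eq_intCast, ← C_eq_intCast]
    exact natDegree_linear_le
  exact natDegree_homEval_le k p (h _ _) (h _ _)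

theorem polyX_mobNumer {k : ℕ} {p : ℂ[X]} (hp : p.natDegree ≤ k) (M : SL(2, ℤ)) :
    polyX (mobNumer M k p) = aeval (mob M coordX) p *
      (((M 1 0 : ℤ) : PlaneField) * coordX + ((M 1 1 : ℤ) : PlaneField)) ^ k := by
  rw [mobNumer, map_homEval, homEval_eq_aeval_mul hp]
  · simp [mob]
  · simpa using coordX_row_ne_zero M 1

theorem aeval_mob_div {k : ℕ} {n d : ℂ[X]} (hn : n.natDegree ≤ k) (hd : d.natDegree ≤ k)
    (M : SL(2, ℤ)) : aeval (mob M coordX) n / aeval (mob M coordX) d =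
      polyX (mobNumer M k n) / polyX (mobNumer M k d) := by
  rw [polyX_mobNumer hn, polyX_mobNumer hd,
    mul_div_mul_right _ _ (pow_ne_zero _ (coordX_row_ne_zero M 1))]

theorem eval_mobNumer {k : ℕ} {p : ℂ[X]} (hp : p.natDegree ≤ k) (M : SL(2, ℤ)) {z : ℂ}
    (hz : ((M 1 0 : ℤ) : ℂ) * z + ((M 1 1 : ℤ) : ℂ) ≠ 0) :
    eval z (mobNumer M k p) =
      eval ((((M 0 0 : ℤ) : ℂ) * z + ((M 0 1 : ℤ) : ℂ)) /
        (((M 1 0 : ℤ) : ℂ) * z + ((M 1 1 : ℤ) : ℂ))) p *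
      (((M 1 0 : ℤ) : ℂ) * z + ((M 1 1 : ℤ) : ℂ)) ^ k := by
  have h := map_homEval (aeval z : ℂ[X] →ₐ[ℂ] ℂ) k p
    (((M 0 0 : ℤ) : ℂ[X]) * X + ((M 0 1 : ℤ) : ℂ[X]))
    (((M 1 0 : ℤ) : ℂ[X]) * X + ((M 1 1 : ℤ) : ℂ[X]))
  simp only [map_add, map_mul, map_intCast, aeval_X] at h
  rw [homEval_eq_aeval_mul hp _ hz] at h
  simpa [mobNumer, coe_aeval_eq_eval] using h

/-! ### Triangular maps and their degree -/

/-- `f` is a triangular map `(M x, a(x) y)`, where the numerator and the denominator of the rational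
function `a` can be taken of degree at most `k`. -/
structure IsTriangular (f : Cremona) (M : SL(2, ℤ)) (k : ℕ) : Prop where
  pullback_x : pullback f coordX = mob M coordX
  pullback_y : ∃ n d : ℂ[X], n ≠ 0 ∧ d ≠ 0 ∧ n.natDegree ≤ k ∧ d.natDegree ≤ k ∧
    pullback f coordY = polyX n / polyX d * coordY

theorem pullback_polyX (f : Cremona) (p : ℂ[X]) :
    pullback f (polyX p) = aeval (pullback f coordX) p :=
  (aeval_algHom_apply (pullback f) coordX p).symm

namespace IsTriangular

variable {f g : Cremona} {M N : SL(2, ℤ)} {k l : ℕ}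

theorem one : IsTriangular 1 1 0 :=
  ⟨by simp, 1, 1, one_ne_zero, one_ne_zero, by simp, by simp, by simp⟩

theorem mobNumer_ne_zero (hf : pullback f coordX = mob M coordX) {p : ℂ[X]} (hp : p ≠ 0)
    (hk : p.natDegree ≤ k) : mobNumer M k p ≠ 0 := by
  intro h
  have h1 := polyX_mobNumer hk M
  rw [h, map_zero, ← hf, ← pullback_polyX, zero_eq_mul] at h1
  rcases h1 with h1 | h1
  · exact polyX_ne_zero hp ((map_eq_zero _).1 h1)
  · exact pow_ne_zero k (coordX_row_ne_zero M 1) h1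

theorem mul (hf : IsTriangular f M k) (hg : IsTriangular g N l) :
    IsTriangular (f * g) (M * N) (k + l) := by
  obtain ⟨hfx, n, d, hn, hd, hnk, hdk, hfy⟩ := hf
  obtain ⟨hgx, n', d', hn', hd', hnl, hdl, hgy⟩ := hg
  refine ⟨by rw [pullback_mul_apply, hfx, pullback_mob, hgx, mob_mob],
    mobNumer N k n * n', mobNumer N k d * d', mul_ne_zero (mobNumer_ne_zero hgx hn hnk) hn',
    mul_ne_zero (mobNumer_ne_zero hgx hd hdk) hd', ?_, ?_, ?_⟩
  · exact natDegree_mul_le.trans (add_le_add (natDegree_mobNumer_le _ _ _) hnl)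
  · exact natDegree_mul_le.trans (add_le_add (natDegree_mobNumer_le _ _ _) hdl)
  · rw [pullback_mul_apply, hfy, map_mul, map_div₀, pullback_polyX, pullback_polyX, hgx,
      aeval_mob_div hnk hdk, hgy, map_mul, map_mul, mul_div_mul_comm, mul_assoc]

theorem inv (hf : IsTriangular f M k) : IsTriangular f⁻¹ M⁻¹ k := by
  obtain ⟨hfx, n, d, hn, hd, hnk, hdk, hfy⟩ := hf
  have hx : pullback f⁻¹ coordX = mob M⁻¹ coordX := by
    have h : pullback f (mob M⁻¹ coordX) = coordX := by
      rw [pullback_mob, hfx, mob_mob, inv_mul_cancel, mob_one]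
    conv_lhs => rw [← h]
    exact pullback_inv_pullback f _
  refine ⟨hx, mobNumer M⁻¹ k d, mobNumer M⁻¹ k n, mobNumer_ne_zero hx hd hdk,
    mobNumer_ne_zero hx hn hnk, natDegree_mobNumer_le _ _ _, natDegree_mobNumer_le _ _ _, ?_⟩
  have h := pullback_inv_pullback f coordY
  rw [hfy, map_mul, map_div₀, pullback_polyX, pullback_polyX, hx, aeval_mob_div hnk hdk] at h
  have h1 := polyX_ne_zero (mobNumer_ne_zero hx hn hnk)
  have h2 := polyX_ne_zero (mobNumer_ne_zero hx hd hdk)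
  conv_rhs => rw [← h]
  field_simp

theorem pow (hf : IsTriangular f M k) (n : ℕ) : IsTriangular (f ^ n) (M ^ n) (n * k) := by
  induction n with
  | zero => simpa using one
  | succ n ih =>
    rw [pow_succ, pow_succ, add_mul, one_mul]
    exact ih.mul hf

end IsTriangular

theorem exists_isHomogeneousForm_degree (f : Cremona) : ∃ F, IsHomogeneousForm f F (degree f) :=
  (exists_homogeneousForm f).choose_spec

/-- A form whose components may have common factors bounds the degree from above. -/
theorem degree_le_of_form {f : Cremona} {G : Fin 3 → MvPolynomial (Fin 3) ℂ} {e : ℕ}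
    (hG : ∀ i, (G i).IsHomogeneous e) (hG0 : dehomogenize (G 2) ≠ 0)
    (hx : pullback f coordX = dehomogenize (G 0) / dehomogenize (G 2))
    (hy : pullback f coordY = dehomogenize (G 1) / dehomogenize (G 2)) : degree f ≤ e := by
  classical
  obtain ⟨F, hF⟩ := exists_isHomogeneousForm_degree f
  have key : ∀ i, F i * G 2 = G i * F 2 := by
    intro i
    have h : dehomogenize (F i * G 2 - G i * F 2) = 0 := by
      have hx' := hF.pullback_x.symm.trans hx
      have hy' := hF.pullback_y.symm.trans hy
      rw [div_eq_div_iff hF.last_ne_zero hG0] at hx' hy'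
      rw [map_sub, map_mul, map_mul, sub_eq_zero]
      fin_cases i
      · exact hx'
      · exact hy'
      · exact mul_comm _ _
    have h2 := (hG i).mul (hF.homogeneous 2)
    rw [add_comm] at h2
    exact sub_eq_zero.1
      (eq_zero_of_dehomogenize_eq_zero (((hF.homogeneous i).mul (hG 2)).sub h2) h)
  let _ : GCDMonoid (MvPolynomial (Fin 3) ℂ) := UniqueFactorizationMonoid.toGCDMonoid _
  have h1 : F 2 ∣ gcd (F 0 * G 2) (gcd (F 1 * G 2) (F 2 * G 2)) :=
    dvd_gcd ⟨G 0, by rw [key, mul_comm]⟩ (dvd_gcd ⟨G 1, by rw [key, mul_comm]⟩ ⟨G 2, rfl⟩)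
  have h2 : Associated (gcd (F 0 * G 2) (gcd (F 1 * G 2) (F 2 * G 2)))
      (gcd (F 0) (gcd (F 1) (F 2)) * G 2) :=
    (Associated.gcd .rfl (gcd_mul_right' _ _ _)).trans (gcd_mul_right' _ _ _)
  have h3 : IsUnit (gcd (F 0) (gcd (F 1) (F 2))) := by
    apply hF.no_common_factor
    intro i
    fin_cases i
    · exact gcd_dvd_left _ _
    · exact (gcd_dvd_right _ _).trans (gcd_dvd_left _ _)
    · exact (gcd_dvd_right _ _).trans (gcd_dvd_right _ _)
  have h4 := h1.trans h2.dvd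
  rw [h3.dvd_mul_left] at h4
  have hF2 : F 2 ≠ 0 := fun h => hF.last_ne_zero (by rw [h, map_zero])
  have hG2 : G 2 ≠ 0 := fun h => hG0 (by rw [h, map_zero])
  have h5 := MvPolynomial.totalDegree_le_of_dvd_of_isDomain h4 hG2
  rwa [(hF.homogeneous 2).totalDegree hF2, (hG 2).totalDegree hG2] at h5

namespace IsTriangular

variable {f : Cremona} {M : SL(2, ℤ)} {k : ℕ}

theorem degree_le (hf : IsTriangular f M k) : degree f ≤ k + 2 := by
  obtain ⟨hfx, n, d, hn, hd, hnk, hdk, hfy⟩ := hf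
  obtain ⟨L, hL⟩ : ∃ L : Fin 2 → MvPolynomial (Fin 3) ℂ, ∀ i, (L i).IsHomogeneous 1 ∧
      dehomogenize (L i) = ((M i 0 : ℤ) : PlaneField) * coordX + ((M i 1 : ℤ) : PlaneField) := by
    refine ⟨fun i => MvPolynomial.C ((M i 0 : ℤ) : ℂ) * MvPolynomial.X 0 +
      MvPolynomial.C ((M i 1 : ℤ) : ℂ) * MvPolynomial.X 2, fun i => ⟨?_, ?_⟩⟩
    · exact ((MvPolynomial.isHomogeneous_X ℂ 0).C_mul _).add
        ((MvPolynomial.isHomogeneous_X ℂ 2).C_mul _)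
    · simp [dehomogenize]
  have hhom : ∀ p : ℂ[X], p.natDegree ≤ k → ∃ H : MvPolynomial (Fin 3) ℂ, H.IsHomogeneous k ∧
      dehomogenize H = polyX p := by
    intro p hp
    refine ⟨homEval k p (MvPolynomial.X 0) (MvPolynomial.X 2), isHomogeneous_homEval k p
      (MvPolynomial.isHomogeneous_X ℂ _) (MvPolynomial.isHomogeneous_X ℂ _), ?_⟩
    rw [map_homEval, show dehomogenize (MvPolynomial.X 2) = 1 by simp [dehomogenize],
      homEval_one hp]
    simp [dehomogenize, polyX]
  obtain ⟨H, hH, hHn⟩ := hhom n hnk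
  obtain ⟨K, hK, hKd⟩ := hhom d hdk
  have hX1 : dehomogenize (MvPolynomial.X 1) = coordY := by simp [dehomogenize]
  have hX2 : dehomogenize (MvPolynomial.X 2) = 1 := by simp [dehomogenize]
  have hrow := coordX_row_ne_zero M 1
  have hd0 := polyX_ne_zero hd
  have e : k + 2 = 1 + k + 1 := by ring
  rw [e]
  refine degree_le_of_form
    (G := ![L 0 * K * MvPolynomial.X 2, L 1 * H * MvPolynomial.X 1, L 1 * K * MvPolynomial.X 2])
    ?_ ?_ ?_ ?_
  · intro i
    fin_cases i
    · exact ((hL 0).1.mul hK).mul (MvPolynomial.isHomogeneous_X ℂ 2)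
    · exact ((hL 1).1.mul hH).mul (MvPolynomial.isHomogeneous_X ℂ 1)
    · exact ((hL 1).1.mul hK).mul (MvPolynomial.isHomogeneous_X ℂ 2)
  · change dehomogenize (L 1 * K * MvPolynomial.X 2) ≠ 0
    rw [map_mul, map_mul, hKd, hX2, (hL 1).2, mul_one]
    exact mul_ne_zero hrow hd0
  · change _ = dehomogenize (L 0 * K * MvPolynomial.X 2) /
      dehomogenize (L 1 * K * MvPolynomial.X 2)
    rw [map_mul, map_mul, map_mul, map_mul, hKd, hX2, (hL 0).2, (hL 1).2, mul_one, mul_one,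
      mul_div_mul_right _ _ hd0, hfx, mob]
  · change _ = dehomogenize (L 1 * H * MvPolynomial.X 1) /
      dehomogenize (L 1 * K * MvPolynomial.X 2)
    rw [map_mul, map_mul, map_mul, map_mul, hHn, hKd, hX1, hX2, (hL 1).2, mul_one, hfy,
      mul_assoc, mul_div_mul_left _ _ hrow]
    ring

/-- The degree bounds the size of the rational function `a` of a triangular map `(M x, a(x) y)`:
restrict a homogeneous form to a general line `y = c`. -/
theorem degree (hf : IsTriangular f M k) : IsTriangular f M (degree f) := by
  obtain ⟨hfx, n, d, hn, hd, -, -, hfy⟩ := hf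
  obtain ⟨F, hF⟩ := exists_isHomogeneousForm_degree f
  let ρ : MvPolynomial (Fin 3) ℂ →ₐ[ℂ] MvPolynomial (Fin 2) ℂ :=
    MvPolynomial.aeval ![MvPolynomial.X 0, MvPolynomial.X 1, 1]
  have hρ : ∀ H, dehomogenize H = algebraMap _ PlaneField (ρ H) := by
    intro H
    have : dehomogenize = (IsScalarTower.toAlgHom ℂ (MvPolynomial (Fin 2) ℂ) PlaneField).comp ρ := by
      ext i
      fin_cases i <;> simp [dehomogenize, ρ, coordX, coordY]
    rw [this]; rfl
  have hpoly : ∀ p, polyX p = algebraMap _ PlaneField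
      (aeval (MvPolynomial.X 0 : MvPolynomial (Fin 2) ℂ) p) := by
    intro p
    have : polyX = (IsScalarTower.toAlgHom ℂ (MvPolynomial (Fin 2) ℂ) PlaneField).comp
        (aeval (MvPolynomial.X 0)) := by
      ext; simp [coordX]
    rw [this]; rfl
  have key : aeval (MvPolynomial.X 0 : MvPolynomial (Fin 2) ℂ) n *
      (MvPolynomial.X 1 * ρ (F 2)) = ρ (F 1) * aeval (MvPolynomial.X 0) d := by
    apply IsFractionRing.injective (MvPolynomial (Fin 2) ℂ) PlaneField
    have h := hfy.symm.trans hF.pullback_y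
    rw [div_mul_eq_mul_div, div_eq_div_iff (polyX_ne_zero hd) hF.last_ne_zero] at h
    simp only [map_mul, ← hρ, ← hpoly]
    rw [← h, coordY]
    ring
  have hne : MvPolynomial.X 1 * ρ (F 2) ≠ 0 := by
    refine mul_ne_zero (MvPolynomial.X_ne_zero _) fun h => hF.last_ne_zero ?_
    rw [hρ, h, map_zero]
  obtain ⟨v, hv⟩ : ∃ v, MvPolynomial.eval v (MvPolynomial.X 1 * ρ (F 2)) ≠ 0 := by
    by_contra! h
    exact hne (MvPolynomial.funext fun v => by rw [h v, map_zero])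
  -- restriction to the line `y = v 1`
  let σ : MvPolynomial (Fin 2) ℂ →ₐ[ℂ] ℂ[X] := MvPolynomial.aeval ![X, C (v 1)]
  have hσn : ∀ p, σ (aeval (MvPolynomial.X 0) p) = p := by
    intro p
    have : σ.comp (aeval (MvPolynomial.X 0)) = AlgHom.id ℂ ℂ[X] := by
      ext; simp [σ]
    exact DFunLike.congr_fun this p
  have hσv : ∀ H, eval (v 0) (σ H) = MvPolynomial.eval v H := by
    intro H
    have : (aeval (v 0)).comp σ = MvPolynomial.aeval v := by
      ext i
      fin_cases i <;> simp [σ]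
    have h := DFunLike.congr_fun this H
    simpa [coe_aeval_eq_eval, MvPolynomial.aeval_eq_eval] using h
  have hσdeg : ∀ i, (σ (ρ (F i))).natDegree ≤ _root_.degree f := by
    intro i
    have : σ.comp ρ = MvPolynomial.aeval ![X, C (v 1), 1] := by
      ext i
      fin_cases i <;> simp [σ, ρ]
    have h : σ (ρ (F i)) = _ := DFunLike.congr_fun this (F i)
    rw [h, ← mul_one (_root_.degree f)]
    refine MvPolynomial.aeval_natDegree_le _ (hF.homogeneous i).totalDegree_le _ fun j => ?_
    fin_cases j <;> simp
  have key' : n * (C (v 1) * σ (ρ (F 2))) = σ (ρ (F 1)) * d := by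
    have := congrArg σ key
    simpa only [map_mul, hσn, show σ (MvPolynomial.X 1) = C (v 1) by simp [σ]] using this
  have h2 : C (v 1) * σ (ρ (F 2)) ≠ 0 := by
    intro h
    apply hv
    rw [← hσv, map_mul, show σ (MvPolynomial.X 1) = C (v 1) by simp [σ], h, eval_zero]
  have h1 : σ (ρ (F 1)) ≠ 0 := by
    intro h
    rw [h, zero_mul] at key'
    exact mul_ne_zero hn h2 key'
  refine ⟨hfx, σ (ρ (F 1)), C (v 1) * σ (ρ (F 2)), h1, h2, hσdeg 1,
    (natDegree_C_mul_le _ _).trans (hσdeg 2), ?_⟩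
  rw [hfy]
  congr 1
  rw [div_eq_div_iff (polyX_ne_zero hd) (polyX_ne_zero h2), ← map_mul, key', map_mul]

end IsTriangular

/-! ### Zeros and poles along the orbit of a zero of `P` -/

/-- The rational function `q` of `x` has no pole at `z`. -/
def IsRegularAt (z : ℂ) (q : PlaneField) : Prop :=
  ∃ n d : ℂ[X], eval z d ≠ 0 ∧ q = polyX n / polyX d

/-- The rational function `q` of `x` vanishes at `z`. -/
def VanishesAt (z : ℂ) (q : PlaneField) : Prop :=
  ∃ n d : ℂ[X], eval z d ≠ 0 ∧ eval z n = 0 ∧ q = polyX n / polyX d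

theorem VanishesAt.isRegularAt {z : ℂ} {q : PlaneField} (h : VanishesAt z q) : IsRegularAt z q := by
  obtain ⟨n, d, hd, -, h⟩ := h
  exact ⟨n, d, hd, h⟩

theorem IsRegularAt.mul {z : ℂ} {q r : PlaneField} (hq : IsRegularAt z q) (hr : IsRegularAt z r) :
    IsRegularAt z (q * r) := by
  obtain ⟨n, d, hd, rfl⟩ := hq
  obtain ⟨n', d', hd', rfl⟩ := hr
  exact ⟨n * n', d * d', by simp [hd, hd'], by rw [map_mul, map_mul, mul_div_mul_comm]⟩

theorem VanishesAt.mul {z : ℂ} {q r : PlaneField} (hq : VanishesAt z q) (hr : IsRegularAt z r) :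
    VanishesAt z (q * r) := by
  obtain ⟨n, d, hd, hn, rfl⟩ := hq
  obtain ⟨n', d', hd', rfl⟩ := hr
  exact ⟨n * n', d * d', by simp [hd, hd'], by simp [hn], by
    rw [map_mul, map_mul, mul_div_mul_comm]⟩

theorem isRegularAt_algebraMap (z a : ℂ) : IsRegularAt z (algebraMap ℂ PlaneField a) :=
  ⟨C a, 1, by simp, by simp⟩

/-- The numerator of any fraction representing a function that vanishes at `z` vanishes at `z`. -/
theorem VanishesAt.eval_eq_zero {z : ℂ} {n d : ℂ[X]} (hd : d ≠ 0)
    (h : VanishesAt z (polyX n / polyX d)) : eval z n = 0 := by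
  obtain ⟨n', d', hd', hn', h⟩ := h
  have hd'0 : d' ≠ 0 := by rintro rfl; simp at hd'
  rw [div_eq_div_iff (polyX_ne_zero hd) (polyX_ne_zero hd'0), ← map_mul, ← map_mul] at h
  have := congrArg (eval z) (polyX_injective h)
  rw [eval_mul, eval_mul, hn', zero_mul] at this
  exact (mul_eq_zero.1 this).resolve_right hd'

theorem moebius_one (p : OnePoint ℂ) : moebius 1 p = p := by simp [moebius]

theorem moebius_mul (M N : SL(2, ℤ)) (p : OnePoint ℂ) :
    moebius (M * N) p = moebius M (moebius N p) := by simp [moebius, mul_smul]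

theorem moebius_eq_coe {M : SL(2, ℤ)} {z w : ℂ} (h : moebius M z = w) :
    ((M 1 0 : ℤ) : ℂ) * z + ((M 1 1 : ℤ) : ℂ) ≠ 0 ∧
      (((M 0 0 : ℤ) : ℂ) * z + ((M 0 1 : ℤ) : ℂ)) /
        (((M 1 0 : ℤ) : ℂ) * z + ((M 1 1 : ℤ) : ℂ)) = w := by
  rw [moebius, OnePoint.smul_some_eq_ite] at h
  simp only [Matrix.SpecialLinearGroup.mapGL_coe_matrix, Matrix.SpecialLinearGroup.map_apply_coe,
    RingHom.mapMatrix_apply, Matrix.map_apply, algebraMap_int_eq, eq_intCast] at h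
  split_ifs at h with h0
  · exact absurd h (OnePoint.infty_ne_coe w)
  · exact ⟨h0, OnePoint.coe_injective h⟩

/-- A point without isotropy is not in the orbit of `∞`. -/
theorem exists_moebius_eq_coe {p : ℂ} (hp : ∀ M : SL(2, ℤ), moebius M p = p → M = 1 ∨ M = -1)
    (M : SL(2, ℤ)) : ∃ z : ℂ, moebius M p = z := by
  rcases h : moebius M p with _ | z
  · exfalso
    have hR : moebius sl2R (OnePoint.infty : OnePoint ℂ) = OnePoint.infty := by
      have h0 : Matrix.SpecialLinearGroup.mapGL ℂ sl2R 1 0 = 0 := by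
        simp only [Matrix.SpecialLinearGroup.mapGL_coe_matrix,
          Matrix.SpecialLinearGroup.map_apply_coe, RingHom.mapMatrix_apply, Matrix.map_apply]
        simp [sl2R]
      rw [moebius, OnePoint.smul_infty_eq_ite, if_pos h0]
    -- the conjugate of `R` by `M` would fix `p`
    have hfix : moebius (M⁻¹ * sl2R * M) p = p := by
      rw [moebius_mul, moebius_mul, h]
      change moebius M⁻¹ (moebius sl2R OnePoint.infty) = p
      rw [hR]
      change moebius M⁻¹ none = p
      rw [← h, ← moebius_mul, inv_mul_cancel, moebius_one]
    have h1 : sl2R = M * (M⁻¹ * sl2R * M) * M⁻¹ := by group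
    have hR1 : sl2R ≠ 1 := by decide
    have hR2 : sl2R ≠ -1 := by decide
    rcases hp _ hfix with h2 | h2
    · rw [h2] at h1
      exact hR1 (by simpa using h1)
    · rw [h2] at h1
      exact hR2 (by simpa using h1)
  · exact ⟨z, rfl⟩

/-- A nonconstant rational function without zero or pole at `∞`, whose zeros and poles lie on
distinct orbits of `SL(2, ℤ)` and have no isotropy; `m` is the number of zeros and of poles, counted
with multiplicity. -/
structure IsGeneric (P : RatFunc ℂ) (m : ℕ) : Prop where
  pos : 0 < m
  num : P.num.natDegree = m
  denom : P.denom.natDegree = m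
  orbits : ∀ p ∈ zerosAndPoles P, ∀ q ∈ zerosAndPoles P, ∀ M : SL(2, ℤ), moebius M p = q → p = q
  free : ∀ p ∈ zerosAndPoles P, ∀ M : SL(2, ℤ), moebius M p = p → M = 1 ∨ M = -1

namespace IsGeneric

variable {P : RatFunc ℂ} {m : ℕ} {p z : ℂ} {g v : SL(2, ℤ)}

theorem ne_zero (hP : IsGeneric P m) : P ≠ 0 := by
  rintro rfl
  have := hP.num
  have := hP.pos
  simp_all

theorem exists_zero (hP : IsGeneric P m) : ∃ p, P.num.IsRoot p :=
  IsAlgClosed.exists_root _ (by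
    rw [degree_eq_natDegree (RatFunc.num_ne_zero hP.ne_zero), hP.num]
    exact_mod_cast hP.pos.ne')

theorem ratSubst_mob (hP : IsGeneric P m) (v : SL(2, ℤ)) : ratSubst P (mob v coordX) =
    polyX (mobNumer v m P.num) / polyX (mobNumer v m P.denom) :=
  aeval_mob_div hP.num.le hP.denom.le v

theorem eval_denom_ne_zero (hP : IsGeneric P m) (hp : P.num.IsRoot p) {w : ℂ}
    (hw : moebius g p = w) : eval w P.denom ≠ 0 := by
  intro h
  obtain rfl := hP.orbits p (.inl hp) w (.inr h) g hw
  obtain ⟨a, b, hab⟩ := P.isCoprime_num_denom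
  have := congrArg (eval p) hab
  rw [IsRoot.def] at hp
  simp [hp, h] at this

theorem eval_mobNumer_denom_ne_zero (hP : IsGeneric P m) (hp : P.num.IsRoot p)
    (hz : moebius g p = z) (v : SL(2, ℤ)) : eval z (mobNumer v m P.denom) ≠ 0 := by
  obtain ⟨w, hw⟩ := exists_moebius_eq_coe (hP.free p (.inl hp)) (v * g)
  have hvz : moebius v z = w := by rw [← hz, ← moebius_mul, hw]
  obtain ⟨h1, h2⟩ := moebius_eq_coe hvz
  rw [eval_mobNumer hP.denom.le v h1, h2]
  exact mul_ne_zero (hP.eval_denom_ne_zero hp hw) (pow_ne_zero _ h1)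

/-- As the poles of `P` are not in the orbit of the zero `p`, no function `P(v x)` has a pole in this
orbit. -/
theorem isRegularAt (hP : IsGeneric P m) (hp : P.num.IsRoot p) (hz : moebius g p = z)
    (v : SL(2, ℤ)) : IsRegularAt z (ratSubst P (mob v coordX)) :=
  ⟨_, _, hP.eval_mobNumer_denom_ne_zero hp hz v, hP.ratSubst_mob v⟩

/-- As `p` is the only zero of `P` in its orbit and has no isotropy, `P(v x)` vanishes at `g p` only
for `v = ±g⁻¹`. -/
theorem isRegularAt_inv (hP : IsGeneric P m) (hp : P.num.IsRoot p) (hz : moebius g p = z)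
    (hv : ¬ (v * g = 1 ∨ v * g = -1)) : IsRegularAt z (ratSubst P (mob v coordX))⁻¹ := by
  refine ⟨mobNumer v m P.denom, mobNumer v m P.num, ?_, by rw [hP.ratSubst_mob, inv_div]⟩
  obtain ⟨w, hw⟩ := exists_moebius_eq_coe (hP.free p (.inl hp)) (v * g)
  have hvz : moebius v z = w := by rw [← hz, ← moebius_mul, hw]
  obtain ⟨h1, h2⟩ := moebius_eq_coe hvz
  rw [eval_mobNumer hP.num.le v h1, h2]
  refine mul_ne_zero (fun h => hv ?_) (pow_ne_zero _ h1)
  obtain rfl := hP.orbits p (.inl hp) w (.inl h) _ hw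
  exact hP.free p (.inl hp) _ hw

theorem vanishesAt (hP : IsGeneric P m) (hp : P.num.IsRoot p) (hz : moebius v⁻¹ p = z) :
    VanishesAt z (ratSubst P (mob v coordX)) := by
  refine ⟨_, _, hP.eval_mobNumer_denom_ne_zero hp hz v, ?_, hP.ratSubst_mob v⟩
  have hvz : moebius v z = p := by rw [← hz, ← moebius_mul, mul_inv_cancel, moebius_one]
  obtain ⟨h1, h2⟩ := moebius_eq_coe hvz
  rw [eval_mobNumer hP.num.le v h1, h2, hp, zero_mul]

end IsGeneric

/-! ### The twisted morphism on words -/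

/-- The rational function `a` such that the morphism maps the word `w` to `(w x, a(x) y)`. -/
noncomputable def wordFactor (P : RatFunc ℂ) : List Bool → PlaneField
  | [] => 1
  | e :: l => algebraMap ℂ PlaneField Complex.I *
      (ratSubst P (mob ((if e then sl2U else sl2U⁻¹) * posWord sl2S sl2U l) coordX) *
        (ratSubst P (mob (posWord sl2S sl2U l) coordX))⁻¹) * wordFactor P l

namespace IsTwistedMorphism

variable {P : RatFunc ℂ} {θ : SL(2, ℤ) →* Cremona}

theorem hasCoords_sl2U (hθ : IsTwistedMorphism P θ) (hP : P ≠ 0) :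
    HasCoords (θ sl2U) (mob sl2U coordX)
      (ratSubst P (mob sl2U coordX) / ratSubst P coordX * coordY) := by
  obtain ⟨-, φ, t, hφ, ht, h⟩ := hθ
  rw [sl2U, h]
  exact hasCoords_conj hP hφ ht

theorem exists_isTriangular {m : ℕ} (hθ : IsTwistedMorphism P θ) (hP : IsGeneric P m)
    (M : SL(2, ℤ)) : ∃ k, IsTriangular (θ M) M k := by
  have hM : M ∈ Subgroup.closure {sl2S, sl2U} := closure_sl2S_sl2U ▸ Subgroup.mem_top M
  induction hM using Subgroup.closure_induction with
  | mem x hx =>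
    rcases hx with rfl | rfl
    · refine ⟨0, by rw [hθ.1.1, mob_sl2S], C Complex.I, 1, by simp, one_ne_zero, by simp, by simp,
        by rw [hθ.1.2]; simp⟩
    · obtain ⟨h1, h2⟩ := hθ.hasCoords_sl2U hP.ne_zero
      have hn := RatFunc.num_ne_zero hP.ne_zero
      have hd := P.denom_ne_zero
      refine ⟨m + m, h1, mobNumer sl2U m P.num * P.denom, mobNumer sl2U m P.denom * P.num,
        mul_ne_zero (IsTriangular.mobNumer_ne_zero h1 hn hP.num.le) hd,
        mul_ne_zero (IsTriangular.mobNumer_ne_zero h1 hd hP.denom.le) hn,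
        natDegree_mul_le.trans (add_le_add (natDegree_mobNumer_le _ _ _) hP.denom.le),
        natDegree_mul_le.trans (add_le_add (natDegree_mobNumer_le _ _ _) hP.num.le), ?_⟩
      rw [h2, hP.ratSubst_mob, ratSubst_coordX, div_div_div_eq, map_mul, map_mul]
  | one => exact ⟨0, by rw [map_one]; exact .one⟩
  | mul x y _ _ hx hy =>
    obtain ⟨k, hk⟩ := hx
    obtain ⟨l, hl⟩ := hy
    exact ⟨k + l, by rw [map_mul]; exact hk.mul hl⟩
  | inv x _ hx =>
    obtain ⟨k, hk⟩ := hx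
    exact ⟨k, by rw [map_inv]; exact hk.inv⟩

theorem hasCoords_letter (hθ : IsTwistedMorphism P θ) (hP : P ≠ 0) (e : Bool) :
    HasCoords (θ (if e then sl2U else sl2U⁻¹)) (mob (if e then sl2U else sl2U⁻¹) coordX)
      (ratSubst P (mob (if e then sl2U else sl2U⁻¹) coordX) * (ratSubst P coordX)⁻¹ * coordY) := by
  have h := hθ.hasCoords_sl2U hP
  cases e
  · simp only [Bool.false_eq_true, if_false, map_inv]
    have hx : pullback (θ sl2U)⁻¹ coordX = mob sl2U⁻¹ coordX := by
      have h' : pullback (θ sl2U) (mob sl2U⁻¹ coordX) = coordX := by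
        rw [pullback_mob, h.1, mob_mob, inv_mul_cancel, mob_one]
      conv_lhs => rw [← h']
      exact pullback_inv_pullback _ _
    refine ⟨hx, ?_⟩
    have hy := pullback_inv_pullback (θ sl2U) coordY
    rw [h.2, map_mul, map_div₀, pullback_ratSubst, pullback_ratSubst, pullback_mob, hx, mob_mob,
      mul_inv_cancel, mob_one] at hy
    have h1 := ratSubst_coordX_ne_zero hP
    have h2 : ratSubst P (mob sl2U⁻¹ coordX) ≠ 0 := by
      rw [← hx, ← pullback_ratSubst]
      exact (_root_.map_ne_zero _).2 h1
    conv_rhs => rw [← hy]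
    field_simp
  · simpa [div_eq_mul_inv] using h

theorem pullback_y_posWord {m : ℕ} (hθ : IsTwistedMorphism P θ) (hP : IsGeneric P m)
    (l : List Bool) :
    pullback (θ (posWord sl2S sl2U l)) coordY = wordFactor P l * coordY := by
  induction l with
  | nil => simp [wordFactor]
  | cons e l ih =>
    obtain ⟨k, hk⟩ := hθ.exists_isTriangular hP (posWord sl2S sl2U l)
    obtain ⟨-, h2⟩ := hθ.hasCoords_letter hP.ne_zero e
    rw [posWord_cons, map_mul, map_mul, pullback_mul_apply, pullback_mul_apply, hθ.1.2, map_mul,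
      AlgEquiv.commutes, h2, map_mul, AlgEquiv.commutes, map_mul, map_mul, map_inv₀,
      pullback_ratSubst, pullback_ratSubst, pullback_mob, hk.pullback_x, mob_mob, ih, wordFactor]
    ring

end IsTwistedMorphism

/-! ### The zeros of the factor of a word -/

/-- Two tails of a word differ by a word, which has trace at least two in absolute value, hence not
by `±U^{±1}`. -/
theorem tail_ne_letter_mul_tail {l l₂ l₃ : List Bool} {e : Bool} {c : SL(2, ℤ)} (h₂ : l₂ <:+ l)
    (h₃ : l₃ <:+ l) (hc : c = 1 ∨ c = -1) : posWord sl2S sl2U l₃ ≠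
      c * ((if e then sl2U else sl2U⁻¹) * posWord sl2S sl2U l₂) := by
  intro h
  rcases List.suffix_or_suffix_of_suffix h₂ h₃ with ⟨l₄, rfl⟩ | ⟨l₄, rfl⟩
  · rw [posWord_append, ← mul_assoc, mul_left_inj] at h
    exact posWord_ne_sl2U hc (by cases e <;> simp) h
  · have h' : posWord sl2S sl2U l₄ = c⁻¹ * (if e then sl2U else sl2U⁻¹)⁻¹ := by
      rw [posWord_append, ← mul_assoc, ← mul_assoc, eq_comm, mul_eq_right] at h
      rw [eq_inv_of_mul_eq_one_right h, mul_inv_rev]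
      rcases hc with rfl | rfl <;> simp
    exact posWord_ne_sl2U (c := c⁻¹) (by rcases hc with rfl | rfl <;> simp)
      (by cases e <;> simp) h'

/-- The matrices `±U^{±1} w₁` attached to the tails `e :: l₁` of a word are distinct: otherwise a
nonempty word would be `±1` or `±U^{±1}`. -/
theorem tail_eq_of_letter_mul_eq {l l₂ l₃ : List Bool} {e e' : Bool} {c : SL(2, ℤ)}
    (h₂ : l₂ <:+ l) (h₃ : l₃ <:+ l) (hc : c = 1 ∨ c = -1)
    (h : (if e then sl2U else sl2U⁻¹) * posWord sl2S sl2U l₂ =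
      c * ((if e' then sl2U else sl2U⁻¹) * posWord sl2S sl2U l₃)) : l₂ = l₃ := by
  have key : ∀ {l₄ : List Bool} {c : SL(2, ℤ)} {e e' : Bool}, (c = 1 ∨ c = -1) →
      (if e then sl2U else sl2U⁻¹) * posWord sl2S sl2U l₄ = c * (if e' then sl2U else sl2U⁻¹) →
      l₄ = [] := by
    intro l₄ c e e' hc h
    have hcomm : ∀ g : SL(2, ℤ), g * c = c * g := by
      rcases hc with rfl | rfl <;> simp
    have h' : posWord sl2S sl2U l₄ =
        c * ((if e then sl2U else sl2U⁻¹)⁻¹ * if e' then sl2U else sl2U⁻¹) := by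
      rw [← mul_assoc, ← hcomm, mul_assoc, ← h, inv_mul_cancel_left]
    by_cases hee : e = e'
    · subst hee
      exact eq_nil_of_posWord_eq hc (by rw [h', inv_mul_cancel, mul_one])
    · have hU : sl2U * sl2U = sl2U⁻¹ := by decide
      have hU' : sl2U⁻¹ * sl2U⁻¹ = sl2U := by decide
      refine absurd h' (posWord_ne_sl2U hc ?_)
      cases e <;> cases e' <;> simp_all
  rcases List.suffix_or_suffix_of_suffix h₂ h₃ with ⟨l₄, rfl⟩ | ⟨l₄, rfl⟩
  · have := key (l₄ := l₄) (c := c⁻¹) (e := e') (e' := e)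
      (by rcases hc with rfl | rfl <;> simp) (by
        rw [posWord_append, ← mul_assoc, ← mul_assoc] at h
        rw [eq_inv_mul_iff_mul_eq, ← mul_assoc]
        exact (mul_right_cancel h).symm)
    rw [this, List.nil_append]
  · have := key (l₄ := l₄) (c := c) (e := e) (e' := e') hc (by
        rw [posWord_append, ← mul_assoc, ← mul_assoc] at h
        exact mul_right_cancel h)
    rw [this, List.nil_append]

section Zeros

variable {P : RatFunc ℂ} {m : ℕ} {p z : ℂ} {g : SL(2, ℤ)}

/-- At a point `g p` of the orbit of the zero `p`, a factor `1 / P(w x)` has a pole only for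
`w = ±g⁻¹`, and the other factors are regular. -/
theorem isRegularAt_wordFactor (hP : IsGeneric P m) (hp : P.num.IsRoot p) (hz : moebius g p = z)
    {l : List Bool} (hl : ∀ l₂, l₂ <:+ l →
      ¬ (posWord sl2S sl2U l₂ * g = 1 ∨ posWord sl2S sl2U l₂ * g = -1)) :
    IsRegularAt z (wordFactor P l) := by
  induction l with
  | nil => exact ⟨1, 1, by simp, by simp [wordFactor]⟩
  | cons e l ih =>
    exact ((isRegularAt_algebraMap z _).mul ((hP.isRegularAt hp hz _).mul
      (hP.isRegularAt_inv hp hz (hl l (List.suffix_cons e l))))).mul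
        (ih fun l₂ h => hl l₂ (h.trans (List.suffix_cons e l)))

theorem vanishesAt_wordFactor (hP : IsGeneric P m) (hp : P.num.IsRoot p) (hz : moebius g p = z)
    {l : List Bool} (hl : ∀ l₂, l₂ <:+ l →
      ¬ (posWord sl2S sl2U l₂ * g = 1 ∨ posWord sl2S sl2U l₂ * g = -1))
    {e : Bool} {l₁ : List Bool} (h₁ : e :: l₁ <:+ l)
    (hg : g = ((if e then sl2U else sl2U⁻¹) * posWord sl2S sl2U l₁)⁻¹) :
    VanishesAt z (wordFactor P l) := by
  induction l with
  | nil => simp at h₁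
  | cons e' l ih =>
    have htail := fun l₂ (h : l₂ <:+ l) => hl l₂ (h.trans (List.suffix_cons e' l))
    have hinv := hP.isRegularAt_inv hp hz (hl l (List.suffix_cons e' l))
    rw [wordFactor]
    rcases List.suffix_cons_iff.1 h₁ with h | h
    · obtain ⟨rfl, rfl⟩ := List.cons_eq_cons.1 h
      rw [mul_comm (algebraMap _ _ _)]
      exact (((hP.vanishesAt hp (by rw [← hg, hz])).mul hinv).mul
        (isRegularAt_algebraMap z _)).mul (isRegularAt_wordFactor hP hp hz htail)
    · rw [mul_comm]
      exact (ih htail h).mul ((isRegularAt_algebraMap z _).mul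
        ((hP.isRegularAt hp hz _).mul hinv))

/-- The factor of a word has as many zeros as the word has letters: for a zero `p` of `P`, each tail
`e :: l₁` of the word gives the zero `(U^{±1} w₁)⁻¹ p`, where `w₁` is the word `l₁`. -/
theorem exists_zeros_wordFactor (hP : IsGeneric P m) (l : List Bool) :
    ∃ z : Fin l.length → ℂ, Function.Injective z ∧ ∀ i, VanishesAt (z i) (wordFactor P l) := by
  obtain ⟨p, hp⟩ := hP.exists_zero
  have hfree := hP.free p (.inl hp)
  let h : Fin l.length → SL(2, ℤ) := fun i =>
    (if l[i] then sl2U else sl2U⁻¹) * posWord sl2S sl2U (l.drop (i + 1))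
  choose z hz using fun i => exists_moebius_eq_coe hfree (h i)⁻¹
  refine ⟨z, fun i j hij => ?_, fun i => ?_⟩
  · have h1 : moebius (h i * (h j)⁻¹) p = p := by
      rw [moebius_mul, hz j, ← hij, ← hz i, ← moebius_mul, mul_inv_cancel, moebius_one]
    have h2 := tail_eq_of_letter_mul_eq (List.drop_suffix _ l) (List.drop_suffix _ l)
      (hfree _ h1) (inv_mul_cancel_right (h i) (h j)).symm
    have h3 := congrArg List.length h2
    simp only [List.length_drop] at h3
    omega
  · refine vanishesAt_wordFactor hP hp (hz i) (fun l₂ h₂ hc => ?_) (e := l[i])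
      (l₁ := l.drop (i + 1)) ?_ rfl
    · exact tail_ne_letter_mul_tail (List.drop_suffix (i + 1 : ℕ) l) h₂ hc
        (inv_mul_cancel_right _ (h i)).symm
    · rw [Fin.getElem_fin, ← List.drop_eq_getElem_cons]
      exact List.drop_suffix _ _

end Zeros

/-- The image of a word is at least as complicated as the word is long. -/
theorem IsTwistedMorphism.length_le {P : RatFunc ℂ} {m : ℕ} {θ : SL(2, ℤ) →* Cremona}
    (hθ : IsTwistedMorphism P θ) (hP : IsGeneric P m) {l : List Bool} {M : SL(2, ℤ)} {k : ℕ}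
    (h : IsTriangular (θ (posWord sl2S sl2U l)) M k) : l.length ≤ k := by
  obtain ⟨-, n, d, hn, hd, hnk, -, hy⟩ := h
  rw [hθ.pullback_y_posWord hP, mul_left_inj' coordY_ne_zero] at hy
  obtain ⟨z, hz, hv⟩ := exists_zeros_wordFactor hP l
  have hroot : ∀ i, z i ∈ n.roots.toFinset := fun i => by
    rw [Multiset.mem_toFinset, mem_roots hn]
    exact (hy ▸ hv i).eval_eq_zero hd
  calc l.length = (Finset.univ.image z).card := by
        rw [Finset.card_image_of_injective _ hz, Finset.card_fin]
    _ ≤ n.roots.toFinset.card := Finset.card_le_card fun w hw => by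
        obtain ⟨i, -, rfl⟩ := Finset.mem_image.1 hw
        exact hroot i
    _ ≤ n.roots.card := n.roots.toFinset_card_le
    _ ≤ k := n.card_roots'.trans hnk

/-! ### Degree growth -/

namespace IsTwistedMorphism

variable {P : RatFunc ℂ} {m : ℕ} {θ : SL(2, ℤ) →* Cremona}

theorem injective (hθ : IsTwistedMorphism P θ) (hP : IsGeneric P m) : Function.Injective θ := by
  rw [injective_iff_map_eq_one]
  intro M hM
  obtain ⟨k, hk⟩ := hθ.exists_isTriangular hP M
  have hx := hk.pullback_x
  rw [hM, pullback_one_apply] at hx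
  refine (eq_one_or_neg_one_of_mob_eq hx.symm).resolve_right ?_
  rintro rfl
  rw [← sl2S_sq, map_pow] at hM
  have h := (quarterTurn_sq hθ.1).2
  rw [hM, pullback_one_apply, self_eq_neg] at h
  exact coordY_ne_zero h

/-- The degrees of the iterates of an element of infinite order grow at least linearly. -/
theorem exists_le_degree_pow (hθ : IsTwistedMorphism P θ) (hP : IsGeneric P m) {M : SL(2, ℤ)}
    (hM : ¬ IsOfFinOrder M) : ∃ b, ∀ n, n ≤ degree (θ M ^ n) + b := by
  obtain ⟨c, g, l, hc, hl, rfl⟩ := exists_conj_posWord hM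
  obtain ⟨k, hk⟩ := hθ.exists_isTriangular hP g
  obtain ⟨k', hk'⟩ := hθ.exists_isTriangular hP (-1)
  have hc' : ∀ n, ∃ j, j ≤ k' ∧ IsTriangular (θ (c ^ n)⁻¹) (c ^ n)⁻¹ j := by
    intro n
    have : (c ^ n)⁻¹ = 1 ∨ (c ^ n)⁻¹ = -1 := by
      rcases hc with rfl | rfl
      · simp
      · rcases n.even_or_odd with h | h
        · simp [h.neg_one_pow]
        · simp [h.neg_one_pow]
    rcases this with h | h <;> rw [h]
    · exact ⟨0, by simp, by rw [map_one]; exact .one⟩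
    · exact ⟨k', le_rfl, hk'⟩
  refine ⟨k' + k + k, fun n => ?_⟩
  obtain ⟨j, hj, hcn⟩ := hc' n
  obtain ⟨l', hl', hw⟩ := posWord_pow (s := sl2S) (u := sl2U) l n
  obtain ⟨k₀, h₀⟩ := hθ.exists_isTriangular hP (c * (g * posWord sl2S sl2U l * g⁻¹))
  -- the iterate of the word is recovered from the iterate of its conjugate
  have h₁ := ((hk.inv.mul (hcn.mul (h₀.pow n).degree)).mul hk)
  rw [← map_pow, ← map_inv, ← map_mul, ← map_mul, ← map_mul] at h₁
  have hcomm : Commute c (g * posWord sl2S sl2U l * g⁻¹) := by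
    rcases hc with rfl | rfl <;> simp
  have heq : g⁻¹ * ((c ^ n)⁻¹ * (c * (g * posWord sl2S sl2U l * g⁻¹)) ^ n) * g =
      posWord sl2S sl2U l' := by
    rw [hcomm.mul_pow, inv_mul_cancel_left, conj_pow, hw]
    group
  rw [heq] at h₁
  have h₂ := hθ.length_le hP h₁
  rw [map_pow] at h₂
  have h₃ : 1 ≤ l.length := List.length_pos_iff.2 hl
  have h₄ : n ≤ n * l.length := Nat.le_mul_of_pos_right n h₃
  omega

theorem isParabolicMap (hθ : IsTwistedMorphism P θ) (hP : IsGeneric P m) {M : SL(2, ℤ)}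
    (hM : ¬ IsOfFinOrder M) : IsParabolicMap (θ M) := by
  left
  obtain ⟨k, hk⟩ := hθ.exists_isTriangular hP M
  obtain ⟨b, hb⟩ := hθ.exists_le_degree_pow hP hM
  constructor
  · refine Asymptotics.IsBigO.of_bound (k + 2) ?_
    filter_upwards [Filter.eventually_ge_atTop 1] with n hn
    have h : degree (θ M ^ n) ≤ n * k + 2 := (hk.pow n).degree_le
    have h' : degree (θ M ^ n) ≤ (k + 2) * n := by nlinarith
    simpa using (by exact_mod_cast h' : (degree (θ M ^ n) : ℝ) ≤ (k + 2) * n)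
  · refine Asymptotics.IsBigO.of_bound 2 ?_
    filter_upwards [Filter.eventually_ge_atTop (2 * b)] with n hn
    have h := hb n
    have h' : n ≤ 2 * degree (θ M ^ n) := by omega
    simpa using (by exact_mod_cast h' : (n : ℝ) ≤ 2 * degree (θ M ^ n))

end IsTwistedMorphism

theorem mainTheorem4 (P : RatFunc ℂ) (m : ℕ) (hm : 0 < m)
    (hnum : P.num.natDegree = m) (hdenom : P.denom.natDegree = m)
    (hzeros : P.num.roots.Nodup) (hpoles : P.denom.roots.Nodup)
    (horbits : ∀ p ∈ zerosAndPoles P, ∀ q ∈ zerosAndPoles P,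
      ∀ M : Matrix.SpecialLinearGroup (Fin 2) ℤ, moebius M p = q → p = q)
    (hfree : ∀ p ∈ zerosAndPoles P,
      ∀ M : Matrix.SpecialLinearGroup (Fin 2) ℤ, moebius M p = p → M = 1 ∨ M = -1) :
    (∃! θ : Matrix.SpecialLinearGroup (Fin 2) ℤ →* Cremona, IsTwistedMorphism P θ) ∧
    ∀ θ : Matrix.SpecialLinearGroup (Fin 2) ℤ →* Cremona,
      IsTwistedMorphism P θ → IsParabolicEmbedding θ := by
  have hP : IsGeneric P m := ⟨hm, hnum, hdenom, horbits, hfree⟩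
  refine ⟨existsUnique_twistedMorphism hP.ne_zero, fun θ hθ => ⟨hθ.injective hP, ?_⟩⟩
  rintro _ ⟨M, rfl⟩ hM
  exact hθ.isParabolicMap hP fun h => hM (θ.isOfFinOrder h)
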